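/- Work in the Euclidean plane. A *constrained* $\overline{\mathsf H}$ is the union of two distinct parallel lines and a line segment (the crossbar) that joins them and is perpendicular to both; all positions and sizes are allowed, so these figures form one class under plane similarities. A *constrained* $\overline{\phi}$ is the union of a circle of positive radius and a (full) line through its center. The number of regions determined by a finite collection of such figures is the number of connected components of the complement of their union. Then, for each of the two shapes $S=\overline{\mathsf H}$ and $S=\overline{\phi}$: (i) two copies of $S$ that have only finitely many points in common (that is, that do not overlap along a line segment or a circular arc) meet in at most $7$ points, and $7$ is attained; (ii) for every integer $n\ge 0$, the maximum number $a_S(n)$ of regions into which $n$ copies of $S$ can divide the plane exists and equals $$a_S(n)=\frac{7n^2-n+2}{2}.$$ -/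

import Mathlib

/-- The Euclidean plane. -/
abbrev Plane : Type := EuclideanSpace ℝ (Fin 2)

/-- The figure with crossbar the segment from `p` to `q`: that segment together with the two
(full, parallel) lines through `p` and through `q` that are perpendicular to it. -/
def hFigure (p q : Plane) : Set Plane :=
  {x | inner ℝ (x - p) (q - p) = 0} ∪ {x | inner ℝ (x - q) (q - p) = 0} ∪ segment ℝ p q

/-- A constrained `H`: two distinct parallel lines joined by a perpendicular line segment.
All positions and sizes are allowed, so this family is a single class under plane similarities. -/
def IsConstrainedH (S : Set Plane) : Prop :=
  ∃ p q : Plane, p ≠ q ∧ S = hFigure p q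

/-- A constrained `φ`: a circle (of positive radius) together with a line through its center. -/
def IsConstrainedPhi (S : Set Plane) : Prop :=
  ∃ (c u : Plane) (r : ℝ), 0 < r ∧ u ≠ 0 ∧
    S = Metric.sphere c r ∪ Set.range (fun t : ℝ => c + t • u)

/-- The number of regions into which `K` divides the plane: the number of connected components
of its complement. -/
noncomputable def numRegions (K : Set Plane) : ℕ∞ :=
  ENat.card (ConnectedComponents ↥(Kᶜ))

/-- The numbers of regions that can be obtained by drawing `n` copies of a shape, where
`shape S` says that the plane set `S` is a copy of the shape. -/
def regionCounts (shape : Set Plane → Prop) (n : ℕ) : Set ℕ∞ :=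
  {r | ∃ S : Fin n → Set Plane, (∀ i, shape (S i)) ∧ r = numRegions (⋃ i, S i)}

/-- The numbers of points in which two copies of a shape can meet, when they meet in only
finitely many points (that is, without overlapping along a piece of a line or circle). -/
def meetingCounts (shape : Set Plane → Prop) : Set ℕ∞ :=
  {k | ∃ S T : Set Plane, shape S ∧ shape T ∧ (S ∩ T).Finite ∧ k = (S ∩ T).encard}

/-! Both formulas for regions come from adding the figures one at a time: a new figure creates at
most `7 * n + 3` regions when `n` figures are present, and a suitable sequence attains this at every
step. Starting from one region, these increments sum to the stated quadratic.

Upper bound. Adding an open arc or a line whose trace on the old set consists of at most `m`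
intervals creates at most `m + 1` regions (`ArcChart.encard_components_union_le`), since removing
one connected piece of curve from an open set adds at most one component
(`encard_components_diff_le`). A circle that meets the old set in `k ≥ 1` points creates at most `k`
regions. An H is two lines and an open crossbar, so its three pieces contribute 3 plus the number of
old pieces each of them meets; of the nine pairs of pieces of two H's at most seven meet
(`card_hPiece_inter_le`), because two crossbars cannot both reach across the other's lines. For φ
the line contributes `3 * n + 1` and the circle `4 * n + 2`.

Lower bound. If a two-sided curve contains points lying in pairwise different regions of the old
complement, each of those regions is split (`encard_components_add_le`). Points on a curve are shown
to lie in different regions by exhibiting sets whose frontier lies in the old figures and whose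
membership switches between the points (`exists_pairwiseSeparated`). The extremal families have a
small increasing parameter `tilt n`, chosen so that any two members cross seven times and no two old
members cross a new one at the same point.

The bound of seven common points uses the same pairs of pieces for H, and the count 2 + 2 + 2 + 1
for circles and lines of φ; explicit pairs attain it. -/

/-! ### Components of a complement when a curve is added. -/

/-- The set of connected components of a subset `U`. -/
def components {X : Type*} [TopologicalSpace X] (U : Set X) : Set (Set X) :=
  connectedComponentIn U '' U

theorem card_connectedComponents_eq_encard {X : Type*} [TopologicalSpace X] (U : Set X) :
    ENat.card (ConnectedComponents U) = (components U).encard := by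
  have hcomp : ∀ x y : U, connectedComponent x = connectedComponent y ↔
      connectedComponentIn U x = connectedComponentIn U y := by
    intro x y
    rw [connectedComponentIn_eq_image x.2, connectedComponentIn_eq_image y.2]
    exact (Set.image_injective.2 Subtype.val_injective).eq_iff.symm
  let f : ConnectedComponents U → components U :=
    Quotient.lift (fun x : U => ⟨connectedComponentIn U x, x, x.2, rfl⟩)
      (fun x y h => Subtype.ext ((hcomp x y).1 h))
  have hf : Function.Bijective f := by
    constructor
    · intro a b
      induction a using Quotient.inductionOn
      induction b using Quotient.inductionOn
      intro h
      exact Quotient.sound ((hcomp _ _).2 (congrArg Subtype.val h))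
    · rintro ⟨_, x, hx, rfl⟩
      exact ⟨Quotient.mk _ ⟨x, hx⟩, rfl⟩
  exact ENat.card_congr (Equiv.ofBijective f hf)

theorem numRegions_eq_encard (K : Set Plane) : numRegions K = (components Kᶜ).encard :=
  card_connectedComponents_eq_encard _

section
variable {X : Type*} [TopologicalSpace X]

theorem mem_connectedComponentIn_of_isPreconnected {U T : Set X} {x y : X} (hT : IsPreconnected T)
    (hTU : T ⊆ U) (hx : x ∈ T) (hy : y ∈ T) : y ∈ connectedComponentIn U x :=
  hT.subset_connectedComponentIn hx hTU hy

/-- The map from components of a smaller set to components of a larger set. -/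
def enlarge (U : Set X) (D : Set X) : Set X := ⋃ x ∈ D, connectedComponentIn U x

theorem enlarge_connectedComponentIn {U V : Set X} (hVU : V ⊆ U) {x : X} (hx : x ∈ V) :
    enlarge U (connectedComponentIn V x) = connectedComponentIn U x := by
  apply subset_antisymm
  · refine Set.iUnion₂_subset fun y hy => ?_
    rw [connectedComponentIn_eq (connectedComponentIn_mono x hVU hy)]
  · exact Set.subset_biUnion_of_mem (u := fun y => connectedComponentIn U y)
      (mem_connectedComponentIn hx)

/-- Off its frontier, the plane is split by the disjoint open sets `interior D` and `(closure D)ᶜ`,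
and a connected set lies in one of them. -/
theorem IsPreconnected.subset_of_disjoint_frontier {T D : Set X} (hT : IsPreconnected T)
    (hD : Disjoint T (frontier D)) (h : (T ∩ D).Nonempty) : T ⊆ D := by
  have := hT.subset_left_of_subset_union (u := interior D) (v := (closure D)ᶜ) isOpen_interior
    isClosed_closure.isOpen_compl
    (Set.disjoint_left.2 fun x hx hx' => hx' (subset_closure (interior_subset hx))) ?_ ?_
  · exact this.trans interior_subset
  · intro x hx
    by_contra hcon
    simp only [Set.mem_union, Set.mem_compl_iff, not_or, not_not] at hcon
    exact Set.disjoint_left.1 hD hx ⟨hcon.2, hcon.1⟩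
  · obtain ⟨x, hx, hxD⟩ := h
    refine ⟨x, hx, ?_⟩
    by_contra hcon
    exact Set.disjoint_left.1 hD hx ⟨subset_closure hxD, hcon⟩

theorem connectedComponentIn_ne_of_frontier {K P : Set X} {x y : X} (hP : frontier P ⊆ K)
    (hx : x ∈ P) (hy : y ∉ P) (hxK : x ∉ K) (hyK : y ∉ K) :
    connectedComponentIn Kᶜ x ≠ connectedComponentIn Kᶜ y := by
  intro h
  refine hy ((isPreconnected_connectedComponentIn (x := x) (F := Kᶜ)).subset_of_disjoint_frontier
    ?_ ⟨x, mem_connectedComponentIn hxK, hx⟩ (h ▸ mem_connectedComponentIn hyK))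
  exact Set.disjoint_left.2 fun z hz hz' => connectedComponentIn_subset _ _ hz (hP hz')

/-- `Sp` and `Sm` are the two sides of the removed curve. A component of `U \ A` meeting neither is
already a component of `U`; one component contains `Sp` and at most one further component meets
`Sm`. So, leaving out the component of `Sp`, passing to components of `U` is injective. -/
theorem encard_components_diff_le [LocallyConnectedSpace X] {U A Sp Sm : Set X}
    (hUA : IsOpen (U \ A)) (hp : IsPreconnected Sp) (hm : IsPreconnected Sm)
    (hpU : Sp ⊆ U \ A) (hmU : Sm ⊆ U \ A) (hpn : Sp.Nonempty)
    (hnhds : ∀ z ∈ A, ∃ W ∈ nhds z, W ⊆ Sp ∪ Sm ∪ A) :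
    (components (U \ A)).encard ≤ (components U).encard + 1 := by
  obtain ⟨p, hpp⟩ := hpn
  set V := U \ A with hV
  have hVU : V ⊆ U := Set.sdiff_subset
  -- Such a component has no frontier point in `U`: near a point of `A` only `Sp`, `Sm` and `A`
  -- itself are found, and it avoids all three.
  have key : ∀ x ∈ V, Disjoint (connectedComponentIn V x) Sp →
      Disjoint (connectedComponentIn V x) Sm →
      connectedComponentIn U x ⊆ connectedComponentIn V x := by
    intro x hx hdp hdm
    refine isPreconnected_connectedComponentIn.subset_of_disjoint_frontier ?_
      ⟨x, mem_connectedComponentIn (hVU hx), mem_connectedComponentIn hx⟩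
    refine Set.disjoint_left.2 fun z hz hz' => ?_
    have hzU := connectedComponentIn_subset _ _ hz
    have hDo : IsOpen (connectedComponentIn V x) := hUA.connectedComponentIn
    rw [hDo.frontier_eq] at hz'
    by_cases hzA : z ∈ A
    · obtain ⟨W, hW, hWs⟩ := hnhds z hzA
      obtain ⟨y, hyW, hyD⟩ := mem_closure_iff_nhds.1 hz'.1 W hW
      rcases hWs hyW with (h | h) | h
      · exact Set.disjoint_left.1 hdp hyD h
      · exact Set.disjoint_left.1 hdm hyD h
      · exact (connectedComponentIn_subset _ _ hyD).2 h
    · have hzV : z ∈ V := ⟨hzU, hzA⟩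
      obtain ⟨y, hyz, hyx⟩ := mem_closure_iff_nhds.1 hz'.1 _
        (connectedComponentIn_mem_nhds (hUA.mem_nhds hzV))
      apply hz'.2
      rw [connectedComponentIn_eq hyx, ← connectedComponentIn_eq hyz]
      exact mem_connectedComponentIn hzV
  have hmeet : ∀ x, ∀ S : Set X, IsPreconnected S → S ⊆ V → ∀ q ∈ S,
      ¬ Disjoint (connectedComponentIn V x) S →
      connectedComponentIn V x = connectedComponentIn V q := by
    intro x S hS hSV q hq hd
    obtain ⟨y, hy, hyS⟩ := Set.not_disjoint_iff.1 hd
    rw [connectedComponentIn_eq hy]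
    exact (connectedComponentIn_eq (mem_connectedComponentIn_of_isPreconnected hS hSV hq hyS)).symm
  set c := connectedComponentIn V p with hc
  have hinj : Set.InjOn (enlarge U) (components V \ {c}) := by
    rintro _ ⟨⟨x, hx, rfl⟩, hxc⟩ _ ⟨⟨y, hy, rfl⟩, hyc⟩ hxy
    rw [enlarge_connectedComponentIn hVU hx, enlarge_connectedComponentIn hVU hy] at hxy
    have hxp : Disjoint (connectedComponentIn V x) Sp := by
      by_contra h; exact hxc (hmeet x Sp hp hpU p hpp h)
    have hyp : Disjoint (connectedComponentIn V y) Sp := by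
      by_contra h; exact hyc (hmeet y Sp hp hpU p hpp h)
    by_cases hxm : Disjoint (connectedComponentIn V x) Sm
    · exact connectedComponentIn_eq (key x hx hxp hxm (hxy ▸ mem_connectedComponentIn (hVU hy)))
    by_cases hym : Disjoint (connectedComponentIn V y) Sm
    · exact (connectedComponentIn_eq
        (key y hy hyp hym (hxy ▸ mem_connectedComponentIn (hVU hx)))).symm
    obtain ⟨q, -, hq⟩ := Set.not_disjoint_iff.1 hxm
    rw [hmeet x Sm hm hmU q hq hxm, hmeet y Sm hm hmU q hq hym]
  calc (components V).encard
      ≤ (components V \ {c}).encard + ({c} : Set (Set X)).encard :=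
        Set.encard_le_encard_sdiff_add_encard _ _
    _ = (enlarge U '' (components V \ {c})).encard + 1 := by
        rw [hinj.encard_image, Set.encard_singleton]
    _ ≤ _ := by
        gcongr
        rintro _ ⟨_, ⟨⟨x, hx, rfl⟩, -⟩, rfl⟩
        exact ⟨x, hVU hx, (enlarge_connectedComponentIn hVU hx).symm⟩

/-- The points of `T` lie in pairwise distinct regions cut out by unions of boundaries in `K`. -/
def PairwiseSeparated (K T : Set X) : Prop :=
  ∀ x ∈ T, ∀ y ∈ T, x ≠ y → ∃ P : Set X, frontier P ⊆ K ∧ (x ∈ P ↔ y ∉ P)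

theorem PairwiseSeparated.injOn {K T : Set X} (h : PairwiseSeparated K T) (hT : T ⊆ Kᶜ) :
    Set.InjOn (connectedComponentIn Kᶜ) T := by
  intro x hx y hy hxy
  by_contra hne
  obtain ⟨P, hP, hP'⟩ := h x hx y hy hne
  by_cases hxP : x ∈ P
  · exact connectedComponentIn_ne_of_frontier hP hxP (hP'.1 hxP) (hT hx) (hT hy) hxy
  · exact connectedComponentIn_ne_of_frontier hP (not_not.1 (mt hP'.2 hxP)) hxP (hT hy) (hT hx)
      hxy.symm

/-- Each old component is recorded at least once on some side of `A`, and one containing a point of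
`T` is recorded on both sides because `A` is accessible from `P` and from `Q`. Points of `T` lie in
different old components, so the extra records number `T.encard`. -/
theorem encard_components_add_le [LocallyConnectedSpace X] {K A P Q T : Set X} (hK : IsClosed K)
    (hP : IsOpen P) (hQ : IsOpen Q) (hPQ : Disjoint P Q) (hcover : (K ∪ A)ᶜ ⊆ P ∪ Q)
    (hA : A \ K ⊆ closure P ∩ closure Q) (hTA : T ⊆ A \ K) (hT : PairwiseSeparated K T) :
    (components Kᶜ).encard + T.encard ≤ (components (K ∪ A)ᶜ).encard := by
  have hsub : (K ∪ A)ᶜ ⊆ Kᶜ := Set.compl_subset_compl.2 Set.subset_union_left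
  have hPA : ∀ x ∈ P, x ∉ K → x ∈ (K ∪ A)ᶜ := by
    rintro x hx hxK (h | h)
    · exact hxK h
    · obtain ⟨y, hy, hy'⟩ := mem_closure_iff.1 (hA ⟨h, hxK⟩).2 P hP hx
      exact Set.disjoint_left.1 hPQ hy hy'
  have hQA : ∀ x ∈ Q, x ∉ K → x ∈ (K ∪ A)ᶜ := by
    rintro x hx hxK (h | h)
    · exact hxK h
    · obtain ⟨y, hy, hy'⟩ := mem_closure_iff.1 (hA ⟨h, hxK⟩).1 Q hQ hx
      exact Set.disjoint_left.1 hPQ hy' hy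
  -- A new component is mapped to the old component around it together with its side of `A`; it lies
  -- wholly in `P` or in `Q`.
  let F : Set X → Set X × Prop := fun D => (enlarge Kᶜ D, (D ∩ P).Nonempty)
  have hFP : ∀ x ∈ P, x ∉ K → F (connectedComponentIn (K ∪ A)ᶜ x) =
      (connectedComponentIn Kᶜ x, True) := by
    intro x hx hxK
    simp only [F, enlarge_connectedComponentIn hsub (hPA x hx hxK), Prod.mk.injEq, true_and,
      eq_iff_iff, iff_true]
    exact ⟨x, mem_connectedComponentIn (hPA x hx hxK), hx⟩
  have hFQ : ∀ x ∈ Q, x ∉ K → F (connectedComponentIn (K ∪ A)ᶜ x) =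
      (connectedComponentIn Kᶜ x, False) := by
    intro x hx hxK
    simp only [F, enlarge_connectedComponentIn hsub (hQA x hx hxK), Prod.mk.injEq, true_and,
      eq_iff_iff, iff_false]
    have : connectedComponentIn (K ∪ A)ᶜ x ⊆ Q :=
      isPreconnected_connectedComponentIn.subset_right_of_subset_union hP hQ hPQ
        ((connectedComponentIn_subset _ _).trans hcover)
        ⟨x, mem_connectedComponentIn (hQA x hx hxK), hx⟩
    rintro ⟨y, hy, hyP⟩
    exact Set.disjoint_left.1 hPQ hyP (this hy)
  have hR : ∀ x ∉ K, ∃ b : Prop, (connectedComponentIn Kᶜ x, b) ∈ F '' components (K ∪ A)ᶜ := by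
    intro x hx
    have hx' : ∃ y ∈ P ∪ Q, y ∈ connectedComponentIn Kᶜ x := by
      by_cases hxA : x ∈ A
      · obtain ⟨y, hy, hy'⟩ := mem_closure_iff_nhds.1 (hA ⟨hxA, hx⟩).1 _
          (connectedComponentIn_mem_nhds (hK.isOpen_compl.mem_nhds hx))
        exact ⟨y, Or.inl hy', hy⟩
      · exact ⟨x, hcover (by simp [hx, hxA]), mem_connectedComponentIn hx⟩
    obtain ⟨y, hyPQ, hyx⟩ := hx'
    have hyK : y ∉ K := connectedComponentIn_subset _ _ hyx
    rw [connectedComponentIn_eq hyx]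
    rcases hyPQ with h | h
    · exact ⟨True, _, ⟨y, hPA y h hyK, rfl⟩, hFP y h hyK⟩
    · exact ⟨False, _, ⟨y, hQA y h hyK, rfl⟩, hFQ y h hyK⟩
  have hboth : ∀ x ∈ T, ∀ b : Prop,
      (connectedComponentIn Kᶜ x, b) ∈ F '' components (K ∪ A)ᶜ := by
    intro x hx b
    have hn := connectedComponentIn_mem_nhds (hK.isOpen_compl.mem_nhds (hTA hx).2)
    by_cases hb : b
    · obtain ⟨y, hy, hyP⟩ := mem_closure_iff_nhds.1 (hA (hTA hx)).1 _ hn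
      have hyK : y ∉ K := connectedComponentIn_subset _ _ hy
      refine ⟨_, ⟨y, hPA y hyP hyK, rfl⟩, ?_⟩
      rw [hFP y hyP hyK, connectedComponentIn_eq hy]
      simp [hb]
    · obtain ⟨y, hy, hyQ⟩ := mem_closure_iff_nhds.1 (hA (hTA hx)).2 _ hn
      have hyK : y ∉ K := connectedComponentIn_subset _ _ hy
      refine ⟨_, ⟨y, hQA y hyQ hyK, rfl⟩, ?_⟩
      rw [hFQ y hyQ hyK, connectedComponentIn_eq hy]
      simp [hb]
  -- `g c` is one side on which `c` is recorded; points of `T` then provide the opposite side `¬ g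
  -- c`, which keeps the two image sets below disjoint.
  have hg : ∀ c : Set X, ∃ b : Prop, c ∈ components Kᶜ →
      (c, b) ∈ F '' components (K ∪ A)ᶜ := by
    intro c
    by_cases hc : c ∈ components Kᶜ
    · obtain ⟨x, hx, rfl⟩ := hc
      obtain ⟨b, hb⟩ := hR x hx
      exact ⟨b, fun _ => hb⟩
    · exact ⟨True, fun h => absurd h hc⟩
  choose g hg using hg
  have hinj := hT.injOn (fun x hx => (hTA hx).2)
  have h1 : ((fun c => (c, g c)) '' components Kᶜ).encard = (components Kᶜ).encard :=
    Set.InjOn.encard_image (fun a _ b _ h => (Prod.mk.inj h).1)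
  have h2 : ((fun x => (connectedComponentIn Kᶜ x, ¬ g (connectedComponentIn Kᶜ x))) '' T).encard
      = T.encard :=
    Set.InjOn.encard_image (fun a ha b hb h => hinj ha hb (Prod.mk.inj h).1)
  rw [← h1, ← h2, ← Set.encard_union_eq]
  · refine (Set.encard_le_encard ?_).trans (Set.encard_image_le F _)
    rintro _ (⟨c, hc, rfl⟩ | ⟨x, hx, rfl⟩)
    · exact hg c hc
    · exact hboth x hx _
  · rw [Set.disjoint_left]
    rintro _ ⟨c, hc, rfl⟩ ⟨x, hx, h⟩
    obtain ⟨h3, h4⟩ := Prod.mk.inj h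
    subst h3
    simp at h4

end

/-! ### Upper bound for one arc, by tubular coordinates. -/

/-- Coordinates near an arc: `(t, s) ↦ Φ (t, s)` parametrizes a neighbourhood of the arc
`t ↦ Φ (t, 0)`, `t ∈ I`, with inverse `z ↦ (param z, height z)`. -/
structure ArcChart (I : Set ℝ) where
  Φ : ℝ × ℝ → Plane
  source : Set Plane
  param : Plane → ℝ
  height : Plane → ℝ
  width : ℝ
  width_pos : 0 < width
  continuous_Φ : Continuous Φ
  isOpen_source : IsOpen source
  continuousOn_param : ContinuousOn param source
  continuousOn_height : ContinuousOn height source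
  right_inv : ∀ z ∈ source, Φ (param z, height z) = z
  left_inv : ∀ t ∈ I, ∀ s, |s| < width →
    Φ (t, s) ∈ source ∧ param (Φ (t, s)) = t ∧ height (Φ (t, s)) = s
  dist_le : ∀ t s, dist (Φ (t, s)) (Φ (t, 0)) ≤ |s|

theorem IsOpen.exists_continuous_radius {U : Set Plane} (hU : IsOpen U) :
    ∃ ε : Plane → ℝ, Continuous ε ∧ ∀ z ∈ U, 0 < ε z ∧ Metric.ball z (ε z) ⊆ U := by
  by_cases h : (Uᶜ).Nonempty
  · refine ⟨fun z => Metric.infDist z Uᶜ, Metric.continuous_infDist_pt _, fun z hz => ?_⟩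
    refine ⟨(hU.isClosed_compl.notMem_iff_infDist_pos h).1 (by simpa using hz), fun y hy => ?_⟩
    by_contra hyU
    have := Metric.infDist_le_dist_of_mem (x := z) (s := Uᶜ) hyU
    rw [Metric.mem_ball, dist_comm] at hy
    linarith
  · rw [Set.not_nonempty_iff_eq_empty, Set.compl_empty_iff] at h
    exact ⟨fun _ => 1, continuous_const, by simp [h]⟩

namespace ArcChart

variable {I : Set ℝ} (C : ArcChart I)

/-- The arc itself. -/
def curve (t : ℝ) : Plane := C.Φ (t, 0)

theorem continuous_curve : Continuous C.curve := C.continuous_Φ.comp (by fun_prop)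

theorem curve_mem_source {t : ℝ} (ht : t ∈ I) : C.curve t ∈ C.source :=
  (C.left_inv t ht 0 (by simpa using C.width_pos)).1

theorem param_curve {t : ℝ} (ht : t ∈ I) : C.param (C.curve t) = t :=
  (C.left_inv t ht 0 (by simpa using C.width_pos)).2.1

theorem height_curve {t : ℝ} (ht : t ∈ I) : C.height (C.curve t) = 0 :=
  (C.left_inv t ht 0 (by simpa using C.width_pos)).2.2

theorem isPreconnected_collar {J : Set ℝ} (hJ : J.OrdConnected) {f : ℝ → ℝ} (hf : Continuous f) :
    IsPreconnected ((fun p : ℝ × ℝ => C.Φ (p.1, p.2 * f p.1)) '' (J ×ˢ Set.Ioo 0 1)) := by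
  refine ((hJ.isPreconnected).prod isPreconnected_Ioo).image _ (Continuous.continuousOn ?_)
  exact C.continuous_Φ.comp (by fun_prop)

/-- The two sides required by `encard_components_diff_le` are collars whose width varies
continuously along the arc, shrinking so as to stay inside `U`. -/
theorem encard_components_diff_image_le {U : Set Plane} (hU : IsOpen U) {J : Set ℝ} (hJI : J ⊆ I)
    (hJo : IsOpen J) (hJ : J.OrdConnected) (hJU : C.curve '' J ⊆ U)
    (hUJ : IsOpen (U \ C.curve '' J)) :
    (components (U \ C.curve '' J)).encard ≤ (components U).encard + 1 := by
  rcases J.eq_empty_or_nonempty with rfl | ⟨j, hj⟩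
  · simp
  obtain ⟨ε, hε, hεU⟩ := hU.exists_continuous_radius
  set η : ℝ → ℝ := fun t => min (ε (C.curve t)) C.width with hη
  have hηc : Continuous η := (hε.comp C.continuous_curve).min continuous_const
  have hηpos : ∀ t ∈ J, 0 < η t := fun t ht =>
    lt_min (hεU _ (hJU ⟨t, ht, rfl⟩)).1 C.width_pos
  have hside : ∀ t ∈ J, ∀ s, s ≠ 0 → |s| < η t → C.Φ (t, s) ∈ U \ C.curve '' J := by
    intro t ht s hs hst
    refine ⟨(hεU _ (hJU ⟨t, ht, rfl⟩)).2 ?_, ?_⟩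
    · exact (C.dist_le t s).trans_lt (hst.trans_le (min_le_left _ _))
    · rintro ⟨t', ht', h⟩
      have h1 := (C.left_inv t (hJI ht) s (hst.trans_le (min_le_right _ _))).2.2
      rw [← h, C.height_curve (hJI ht')] at h1
      exact hs h1.symm
  have hscale : ∀ t ∈ J, ∀ u ∈ Set.Ioo (0 : ℝ) 1, 0 < u * η t ∧ u * η t < η t := by
    intro t ht u hu
    have := hηpos t ht
    exact ⟨mul_pos hu.1 this, by nlinarith [hu.2]⟩
  refine encard_components_diff_le hUJ (C.isPreconnected_collar hJ hηc)
    (C.isPreconnected_collar hJ hηc.neg) ?_ ?_ ?_ ?_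
  · rintro _ ⟨⟨t, u⟩, ⟨ht, hu⟩, rfl⟩
    have := hscale t ht u hu
    exact hside t ht _ this.1.ne' (by simpa [abs_of_pos this.1] using this.2)
  · rintro _ ⟨⟨t, u⟩, ⟨ht, hu⟩, rfl⟩
    have := hscale t ht u hu
    refine hside t ht _ (by simpa using this.1.ne') ?_
    simpa [abs_of_pos this.1, abs_neg] using this.2
  · exact ⟨_, ⟨j, 1 / 2⟩, ⟨hj, by norm_num⟩, rfl⟩
  · rintro _ ⟨t, ht, rfl⟩
    refine ⟨_, ?_, subset_rfl⟩
    have hs := C.isOpen_source.mem_nhds (C.curve_mem_source (hJI ht))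
    have ha : ContinuousAt C.param (C.curve t) := C.continuousOn_param.continuousAt hs
    have hh : ContinuousAt C.height (C.curve t) := C.continuousOn_height.continuousAt hs
    have h1 : ∀ᶠ z in nhds (C.curve t), C.param z ∈ J :=
      ha.eventually_mem (by rw [C.param_curve (hJI ht)]; exact hJo.mem_nhds ht)
    have h2 : ∀ᶠ z in nhds (C.curve t), |C.height z| < η (C.param z) := by
      refine (hh.abs).eventually_lt (hηc.continuousAt.comp ha) ?_
      simpa [C.param_curve (hJI ht), C.height_curve (hJI ht)] using hηpos t ht
    filter_upwards [h1, h2, hs] with z hz1 hz2 hz3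
    have hp := hηpos _ hz1
    have hz := C.right_inv z hz3
    rcases lt_trichotomy (C.height z) 0 with h | h | h
    · left; right
      refine ⟨⟨C.param z, -C.height z / η (C.param z)⟩, ⟨hz1, div_pos (by linarith) hp, ?_⟩, ?_⟩
      · rw [div_lt_one hp]; exact (neg_le_abs _).trans_lt hz2
      · have : -C.height z / η (C.param z) * (-η) (C.param z) = C.height z := by
          rw [Pi.neg_apply]; field_simp
        simp only [this, hz]
    · right
      exact ⟨C.param z, hz1, by rw [curve, ← h, hz]⟩
    · left; left
      refine ⟨⟨C.param z, C.height z / η (C.param z)⟩, ⟨hz1, div_pos h hp, ?_⟩, ?_⟩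
      · rw [div_lt_one hp]; exact (le_abs_self _).trans_lt hz2
      · have : C.height z / η (C.param z) * η (C.param z) = C.height z := by field_simp
        simp only [this, hz]

/-- The traces `Z i` cut the arc into at most `m + 1` intervals outside `K`, which are removed one
after another. No finiteness of the intersection is needed, so overlaps along whole intervals are
allowed. -/
theorem encard_components_union_le (hIo : IsOpen I) (hI : I.OrdConnected) {K : Set Plane}
    (hK : IsClosed K) (hKA : IsClosed (K ∪ C.curve '' I)) {ι : Type*} [Finite ι]
    (Z : ι → Set ℝ) (hZ : ∀ i, (Z i).OrdConnected)
    (hcov : ∀ t ∈ I, (C.curve t ∈ K ↔ ∃ i, t ∈ Z i)) :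
    (components (K ∪ C.curve '' I)ᶜ).encard ≤
      (components Kᶜ).encard + ({i | (Z i).Nonempty}.ncard + 1 : ℕ) := by
  set m := {i | (Z i).Nonempty}.ncard with hm
  -- `r t` counts the traces that have begun before `t`. It labels the gaps: it is locally constant
  -- off the traces and increases strictly across each of them. Some labels in `0, …, m` may have an
  -- empty gap.
  set B : ℝ → Set ι := fun t => {i | ∃ z ∈ Z i, z < t} with hB
  set r : ℝ → ℕ := fun t => (B t).ncard with hr
  have hBmono : ∀ s t, s ≤ t → B s ⊆ B t := fun s t hst i ⟨z, hz, hzs⟩ =>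
    ⟨z, hz, hzs.trans_le hst⟩
  have hrmono : ∀ s t, s ≤ t → r s ≤ r t := fun s t hst =>
    Set.ncard_le_ncard (hBmono s t hst) (Set.toFinite _)
  have hrm : ∀ t, r t < m + 1 := fun t => Nat.lt_succ_of_le
    (Set.ncard_le_ncard (fun i ⟨z, hz, _⟩ => ⟨z, hz⟩) (Set.toFinite _))
  set J : ℕ → Set ℝ := fun j => {t | t ∈ I ∧ C.curve t ∉ K ∧ r t = j} with hJ
  have hG : IsOpen (I ∩ C.curve ⁻¹' Kᶜ) := hIo.inter (hK.isOpen_compl.preimage C.continuous_curve)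
  have hJo : ∀ j, IsOpen (J j) := by
    intro j
    rw [isOpen_iff_mem_nhds]
    rintro t ⟨htI, htK, htj⟩
    obtain ⟨l, u, htlu, hlu⟩ := mem_nhds_iff_exists_Ioo_subset.1 (hG.mem_nhds ⟨htI, htK⟩)
    refine Filter.mem_of_superset (Ioo_mem_nhds htlu.1 htlu.2) fun s hs => ?_
    have hBle : ∀ a ∈ Set.Ioo l u, ∀ b ∈ Set.Ioo l u, B a ⊆ B b := by
      rintro a ha b hb i ⟨z, hz, hza⟩
      refine ⟨z, hz, ?_⟩
      by_contra hzb
      have hz' : z ∈ Set.Ioo l u := ⟨hb.1.trans_le (not_lt.1 hzb), hza.trans ha.2⟩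
      exact (hlu hz').2 ((hcov z (hlu hz').1).2 ⟨i, hz⟩)
    refine ⟨(hlu hs).1, (hlu hs).2, ?_⟩
    rw [← htj, hr]
    simp only [(hBle s hs t htlu).antisymm (hBle t htlu s hs)]
  have hJord : ∀ j, (J j).OrdConnected := by
    intro j
    rw [Set.ordConnected_iff]
    rintro a ⟨haI, haK, haj⟩ b ⟨hbI, hbK, hbj⟩ hab c ⟨hac, hcb⟩
    have hcI : c ∈ I := hI.out haI hbI ⟨hac, hcb⟩
    refine ⟨hcI, fun hcK => ?_, le_antisymm (hbj ▸ hrmono c b hcb) (haj ▸ hrmono a c hac)⟩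
    obtain ⟨i, hi⟩ := (hcov c hcI).1 hcK
    have haZ : a ∉ Z i := fun h => haK ((hcov a haI).2 ⟨i, h⟩)
    have hbc : c ≠ b := fun h => hbK (h ▸ hcK)
    have : r a < r b := by
      refine Set.ncard_lt_ncard ⟨hBmono a b hab, fun hsub => ?_⟩ (Set.toFinite _)
      obtain ⟨z, hz, hza⟩ := hsub ⟨c, hi, lt_of_le_of_ne hcb hbc⟩
      exact haZ ((hZ i).out hz hi ⟨hza.le, hac⟩)
    omega
  have hJdisj : ∀ i j t, t ∈ J i → t ∈ J j → i = j := fun i j t hi hj => hi.2.2 ▸ hj.2.2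
  -- `V j` is the complement of `K` with the gaps of label below `j` removed, so it leads from `Kᶜ`
  -- at `j = 0` to the final set at `j = m + 1`.
  set V : ℕ → Set Plane := fun j => Kᶜ \ C.curve '' {t | t ∈ I ∧ C.curve t ∉ K ∧ r t < j} with hV
  have hVo : ∀ j, IsOpen (V j) := by
    intro j
    rw [isOpen_iff_mem_nhds]
    rintro z ⟨hzK, hz⟩
    by_cases hzI : z ∈ C.curve '' I
    · obtain ⟨t, ht, rfl⟩ := hzI
      have htJ : t ∈ J (r t) := ⟨ht, hzK, rfl⟩
      have hrt : ¬ r t < j := fun h => hz ⟨t, ⟨ht, hzK, h⟩, rfl⟩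
      have hO : IsOpen (C.source ∩ C.param ⁻¹' (J (r t))) :=
        C.continuousOn_param.isOpen_inter_preimage C.isOpen_source (hJo _)
      have hmem : C.curve t ∈ C.source ∩ C.param ⁻¹' (J (r t)) :=
        ⟨C.curve_mem_source ht, by rw [Set.mem_preimage, C.param_curve ht]; exact htJ⟩
      filter_upwards [hO.mem_nhds hmem, hK.isOpen_compl.mem_nhds hzK] with y hy hyK
      refine ⟨hyK, ?_⟩
      rintro ⟨s, ⟨hsI, -, hsj⟩, rfl⟩
      have := hy.2.2.2
      rw [C.param_curve hsI] at this
      omega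
    · filter_upwards [hKA.isOpen_compl.mem_nhds (show z ∉ K ∪ C.curve '' I by
        rintro (h | h); exacts [hzK h, hzI h])] with y hy
      refine ⟨fun h => hy (Or.inl h), ?_⟩
      rintro ⟨s, ⟨hsI, -⟩, rfl⟩
      exact hy (Or.inr ⟨s, hsI, rfl⟩)
  have hVsucc : ∀ j, V (j + 1) = V j \ C.curve '' J j := by
    intro j
    rw [hV, hJ]
    simp only [Set.sdiff_sdiff, ← Set.image_union]
    congr 2
    ext t
    simp only [Set.mem_ofPred_eq, Set.mem_union, Nat.lt_succ_iff_lt_or_eq]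
    tauto
  have hstep : ∀ j, (components (V j)).encard ≤ (components Kᶜ).encard + (j : ℕ) := by
    intro j
    induction j with
    | zero => simp [hV]
    | succ j ih =>
      have hle := C.encard_components_diff_image_le (hVo j) (J := J j) (fun t ht => ht.1) (hJo j)
        (hJord j) ?_ (by rw [← hVsucc]; exact hVo _)
      · rw [hVsucc]
        refine hle.trans ((add_le_add_left ih 1).trans (le_of_eq ?_))
        push_cast
        rw [add_assoc]
      · rintro _ ⟨t, ⟨htI, htK, htj⟩, rfl⟩
        refine ⟨htK, ?_⟩
        rintro ⟨s, ⟨hsI, -, hsj⟩, h⟩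
        have : s = t := by rw [← C.param_curve hsI, h, C.param_curve htI]
        subst this
        omega
  have hend : (K ∪ C.curve '' I)ᶜ = V (m + 1) := by
    ext z
    constructor
    · intro hz
      refine ⟨fun h => hz (Or.inl h), ?_⟩
      rintro ⟨t, ht, rfl⟩
      exact hz (Or.inr ⟨t, ht.1, rfl⟩)
    · rintro ⟨hzK, hz⟩ (h | ⟨t, ht, rfl⟩)
      · exact hzK h
      · exact hz ⟨t, ⟨ht, hzK, hrm t⟩, rfl⟩
  rw [hend]
  exact hstep (m + 1)

end ArcChart

/-! ### Coordinates along lines and circles. -/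

theorem inner_plane (x y : Plane) : inner ℝ x y = x 0 * y 0 + x 1 * y 1 := by
  simp [PiLp.inner_apply, Fin.sum_univ_two, mul_comm]

theorem norm_sq_plane (x : Plane) : ‖x‖ ^ 2 = x 0 ^ 2 + x 1 ^ 2 := by
  simp [EuclideanSpace.norm_sq_eq, Fin.sum_univ_two]

theorem plane_ext {x y : Plane} (h0 : x 0 = y 0) (h1 : x 1 = y 1) : x = y := by
  ext i; fin_cases i <;> assumption

theorem plane_ne_zero_iff {d : Plane} : d ≠ 0 ↔ 0 < d 0 ^ 2 + d 1 ^ 2 := by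
  rw [← norm_sq_plane, ← norm_pos_iff]
  exact ⟨fun h => by positivity, fun h => (norm_nonneg d).lt_of_ne (by rintro h'; simp [← h'] at h)⟩

theorem mem_sphere_plane {c x : Plane} {r : ℝ} (hr : 0 ≤ r) :
    x ∈ Metric.sphere c r ↔ (x 0 - c 0) ^ 2 + (x 1 - c 1) ^ 2 = r ^ 2 := by
  rw [mem_sphere_iff_norm, ← sq_eq_sq₀ (norm_nonneg _) hr, norm_sq_plane]
  simp

/-- Rotation by a right angle. -/
noncomputable def rot (d : Plane) : Plane := !₂[-d 1, d 0]

@[simp] theorem rot_zero (d : Plane) : rot d 0 = -d 1 := rfl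

@[simp] theorem rot_one (d : Plane) : rot d 1 = d 0 := rfl

theorem norm_rot (d : Plane) : ‖rot d‖ = ‖d‖ := by
  rw [← sq_eq_sq₀ (norm_nonneg _) (norm_nonneg _), norm_sq_plane, norm_sq_plane]
  simp [add_comm]

/-- Cartesian coordinates along a line. -/
noncomputable def lineChart (p d : Plane) (hd : d ≠ 0) (I : Set ℝ) : ArcChart I where
  Φ q := p + q.1 • d + (q.2 / ‖d‖) • rot d
  source := Set.univ
  param z := inner ℝ (z - p) d / ‖d‖ ^ 2
  height z := inner ℝ (z - p) (rot d) / ‖d‖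
  width := 1
  width_pos := one_pos
  continuous_Φ := by fun_prop
  isOpen_source := isOpen_univ
  continuousOn_param := by fun_prop
  continuousOn_height := by fun_prop
  right_inv z _ := by
    have hn : 0 < ‖d‖ := norm_pos_iff.2 hd
    have h2 : ‖d‖ ^ 2 = d 0 ^ 2 + d 1 ^ 2 := norm_sq_plane d
    apply plane_ext
    · simp only [inner_plane, PiLp.add_apply, PiLp.smul_apply, PiLp.sub_apply, smul_eq_mul,
        rot_zero, rot_one]
      field_simp
      rw [h2]; ring
    · simp only [inner_plane, PiLp.add_apply, PiLp.smul_apply, PiLp.sub_apply, smul_eq_mul,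
        rot_zero, rot_one]
      field_simp
      rw [h2]; ring
  left_inv t _ s _ := by
    have hn : 0 < ‖d‖ := norm_pos_iff.2 hd
    have h2 : ‖d‖ ^ 2 = d 0 ^ 2 + d 1 ^ 2 := norm_sq_plane d
    refine ⟨trivial, ?_, ?_⟩
    · simp only [inner_plane, PiLp.add_apply, PiLp.smul_apply, PiLp.sub_apply, smul_eq_mul,
        rot_zero, rot_one]
      field_simp
      linear_combination (-(t * ‖d‖)) * h2
    · simp only [inner_plane, PiLp.add_apply, PiLp.smul_apply, PiLp.sub_apply, smul_eq_mul,
        rot_zero, rot_one]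
      field_simp
      rw [h2]; ring
  dist_le t s := by
    have hn : 0 < ‖d‖ := norm_pos_iff.2 hd
    simp [dist_eq_norm, norm_smul, norm_rot, hn.ne']

theorem lineChart_curve (p d : Plane) (hd : d ≠ 0) (I : Set ℝ) (t : ℝ) :
    (lineChart p d hd I).curve t = p + t • d := by
  simp [lineChart, ArcChart.curve]

/-- The complex coordinate with origin `c` and unit `u`. -/
noncomputable def complexCoord (c u z : Plane) : ℂ :=
  ⟨inner ℝ (z - c) u / ‖u‖ ^ 2, inner ℝ (z - c) (rot u) / ‖u‖ ^ 2⟩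

theorem continuous_complexCoord (c u : Plane) : Continuous (complexCoord c u) := by
  have : complexCoord c u = fun z => ((inner ℝ (z - c) u / ‖u‖ ^ 2 : ℝ) : ℂ) +
      ((inner ℝ (z - c) (rot u) / ‖u‖ ^ 2 : ℝ) : ℂ) * Complex.I := by
    ext z; exact (Complex.mk_eq_add_mul_I _ _)
  rw [this]
  fun_prop

theorem eq_of_complexCoord {c u z : Plane} (hu : u ≠ 0) :
    c + (complexCoord c u z).re • u + (complexCoord c u z).im • rot u = z := by
  have hn : 0 < ‖u‖ := norm_pos_iff.2 hu
  have h2 : ‖u‖ ^ 2 = u 0 ^ 2 + u 1 ^ 2 := norm_sq_plane u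
  have h3 : u 0 ^ 2 + u 1 ^ 2 ≠ 0 := by rw [← h2]; positivity
  apply plane_ext
  · simp only [complexCoord, inner_plane, PiLp.add_apply, PiLp.smul_apply, PiLp.sub_apply,
      smul_eq_mul, rot_zero, rot_one, h2]
    field_simp; ring
  · simp only [complexCoord, inner_plane, PiLp.add_apply, PiLp.smul_apply, PiLp.sub_apply,
      smul_eq_mul, rot_zero, rot_one, h2]
    field_simp; ring

theorem complexCoord_polar {c u : Plane} (hu : u ≠ 0) (ρ t : ℝ) :
    complexCoord c u (c + ρ • (Real.cos t • u + Real.sin t • rot u)) =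
      ρ * (Complex.cos t + Complex.sin t * Complex.I) := by
  have h2 : ‖u‖ ^ 2 = u 0 ^ 2 + u 1 ^ 2 := norm_sq_plane u
  have h3 : u 0 ^ 2 + u 1 ^ 2 ≠ 0 := (plane_ne_zero_iff.1 hu).ne'
  rw [← Complex.ofReal_cos, ← Complex.ofReal_sin]
  apply Complex.ext
  · simp only [complexCoord, inner_plane, PiLp.add_apply, PiLp.smul_apply, PiLp.sub_apply,
      smul_eq_mul, rot_zero, rot_one, h2]
    simp [-Complex.ofReal_cos, -Complex.ofReal_sin]
    field_simp; ring
  · simp only [complexCoord, inner_plane, PiLp.add_apply, PiLp.smul_apply, PiLp.sub_apply,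
      smul_eq_mul, rot_zero, rot_one, h2]
    simp [-Complex.ofReal_cos, -Complex.ofReal_sin]
    field_simp; ring

theorem norm_cos_smul_add_sin_smul_rot (u : Plane) (t : ℝ) :
    ‖Real.cos t • u + Real.sin t • rot u‖ = ‖u‖ := by
  rw [← sq_eq_sq₀ (norm_nonneg _) (norm_nonneg _), norm_sq_plane, norm_sq_plane]
  simp
  linear_combination (u 0 ^ 2 + u 1 ^ 2) * Real.sin_sq_add_cos_sq t

/-- Polar coordinates along the circle with centre `c` through `c + u`, cut at `c - u`. -/
noncomputable def circleChart (c u : Plane) (hu : u ≠ 0) :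
    ArcChart (Set.Ioo (-Real.pi) Real.pi) where
  Φ q := c + (1 + q.2 / ‖u‖) • (Real.cos q.1 • u + Real.sin q.1 • rot u)
  source := complexCoord c u ⁻¹' Complex.slitPlane
  param z := (complexCoord c u z).arg
  height z := ‖u‖ * (‖complexCoord c u z‖ - 1)
  width := ‖u‖
  width_pos := norm_pos_iff.2 hu
  continuous_Φ := by fun_prop
  isOpen_source := Complex.isOpen_slitPlane.preimage (continuous_complexCoord c u)
  continuousOn_param z hz :=
    ((Complex.continuousAt_arg hz).comp (continuous_complexCoord c u).continuousAt)
      |>.continuousWithinAt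
  continuousOn_height := by
    have := continuous_complexCoord c u
    fun_prop
  right_inv z _ := by
    have hn : 0 < ‖u‖ := norm_pos_iff.2 hu
    have h : 1 + ‖u‖ * (‖complexCoord c u z‖ - 1) / ‖u‖ = ‖complexCoord c u z‖ := by
      field_simp; ring
    rw [h, smul_add, smul_smul, smul_smul, Complex.norm_mul_cos_arg, Complex.norm_mul_sin_arg,
      ← add_assoc, eq_of_complexCoord hu]
  left_inv t ht s hs := by
    have hn : 0 < ‖u‖ := norm_pos_iff.2 hu
    have hρ : 0 < 1 + s / ‖u‖ := by
      have := neg_abs_le s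
      have h1 : -1 < s / ‖u‖ := by rw [lt_div_iff₀ hn]; linarith
      linarith
    have harg := Complex.arg_mul_cos_add_sin_mul_I hρ ⟨ht.1, ht.2.le⟩
    rw [← complexCoord_polar (c := c) hu] at harg
    refine ⟨?_, harg, ?_⟩
    · rw [Set.mem_preimage, Complex.mem_slitPlane_iff_arg, harg]
      refine ⟨ht.2.ne, ?_⟩
      rw [complexCoord_polar hu, Complex.cos_add_sin_I]
      exact mul_ne_zero (by exact_mod_cast hρ.ne') (Complex.exp_ne_zero _)
    · simp only [complexCoord_polar hu, Complex.cos_add_sin_I, norm_mul,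
        Complex.norm_exp_ofReal_mul_I, Complex.norm_real, Real.norm_eq_abs, abs_of_pos hρ]
      field_simp; ring
  dist_le t s := by
    have hn : 0 < ‖u‖ := norm_pos_iff.2 hu
    have h : (1 + s / ‖u‖) • (Real.cos t • u + Real.sin t • rot u) -
        (1 + 0 / ‖u‖) • (Real.cos t • u + Real.sin t • rot u) =
        (s / ‖u‖) • (Real.cos t • u + Real.sin t • rot u) := by
      rw [← sub_smul]; congr 1; ring
    simp only [dist_eq_norm, add_sub_add_left_eq_sub, h]
    rw [norm_smul, norm_cos_smul_add_sin_smul_rot]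
    simp [hn.ne']

theorem circleChart_curve (c u : Plane) (hu : u ≠ 0) (t : ℝ) :
    (circleChart c u hu).curve t = c + (Real.cos t • u + Real.sin t • rot u) := by
  simp [circleChart, ArcChart.curve]

theorem circleChart_image (c u : Plane) (hu : u ≠ 0) :
    (circleChart c u hu).curve '' Set.Ioo (-Real.pi) Real.pi =
      Metric.sphere c ‖u‖ \ {c - u} := by
  have hn : 0 < ‖u‖ := norm_pos_iff.2 hu
  ext z
  constructor
  · rintro ⟨t, ht, rfl⟩
    refine ⟨?_, fun h => ?_⟩
    · rw [circleChart_curve, mem_sphere_iff_norm, add_sub_cancel_left,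
        norm_cos_smul_add_sin_smul_rot]
    · have h1 := (circleChart c u hu).param_curve ht
      rw [Set.mem_singleton_iff.1 h] at h1
      have h2 : c - u = c + (1 : ℝ) • (Real.cos Real.pi • u + Real.sin Real.pi • rot u) := by
        simp [sub_eq_add_neg]
      change (complexCoord c u (c - u)).arg = t at h1
      rw [h2, complexCoord_polar hu] at h1
      simp at h1
      exact ht.2.ne h1.symm
  · rintro ⟨hz, hzne⟩
    have hz' := eq_of_complexCoord (c := c) (z := z) hu
    have hnorm : ‖complexCoord c u z‖ = 1 := by
      rw [mem_sphere_iff_norm] at hz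
      have h1 : ‖z - c‖ ^ 2 = ‖u‖ ^ 2 := by rw [hz]
      have h2 : ‖z - c‖ ^ 2 = ‖complexCoord c u z‖ ^ 2 * ‖u‖ ^ 2 := by
        have h3 : z - c = (complexCoord c u z).re • u + (complexCoord c u z).im • rot u := by
          conv_lhs => rw [← hz']
          abel
        rw [h3, norm_sq_plane, norm_sq_plane, Complex.sq_norm, Complex.normSq_apply]
        simp
        ring
      have h4 : ‖complexCoord c u z‖ ^ 2 = 1 := by
        have : ‖u‖ ^ 2 ≠ 0 := by positivity
        apply mul_right_cancel₀ this
        rw [← h2, h1, one_mul]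
      nlinarith [norm_nonneg (complexCoord c u z)]
    have hre := Complex.norm_mul_cos_arg (complexCoord c u z)
    have him := Complex.norm_mul_sin_arg (complexCoord c u z)
    rw [hnorm, one_mul] at hre him
    refine ⟨(complexCoord c u z).arg, ⟨Complex.neg_pi_lt_arg _, ?_⟩, ?_⟩
    · refine lt_of_le_of_ne (Complex.arg_le_pi _) fun h => hzne ?_
      rw [h] at hre him
      rw [Set.mem_singleton_iff, ← hz', ← hre, ← him]
      simp [sub_eq_add_neg]
    · rw [circleChart_curve, hre, him, ← add_assoc, hz']

/-- A convex set meets a line in an interval, so the convex pieces `A i` supply the order-connected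
traces. -/
theorem numRegions_union_line_le {K : Set Plane} (hK : IsClosed K) (p d : Plane) (hd : d ≠ 0)
    {I : Set ℝ} (hIo : IsOpen I) (hI : I.OrdConnected)
    (hKL : IsClosed (K ∪ (fun t : ℝ => p + t • d) '' I)) {ι : Type*} [Finite ι]
    (A : ι → Set Plane) (hA : ∀ i, Convex ℝ (A i))
    (hcov : (fun t : ℝ => p + t • d) '' I ∩ K = (fun t : ℝ => p + t • d) '' I ∩ ⋃ i, A i) :
    numRegions (K ∪ (fun t : ℝ => p + t • d) '' I) ≤ numRegions K +
      ({i | ((fun t : ℝ => p + t • d) '' I ∩ A i).Nonempty}.ncard + 1 : ℕ) := by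
  have hcurve : (lineChart p d hd I).curve = fun t => p + t • d :=
    funext (lineChart_curve p d hd I)
  have h := (lineChart p d hd I).encard_components_union_le hIo hI hK (by rwa [hcurve])
    (fun i => I ∩ (fun t : ℝ => p + t • d) ⁻¹' A i) (fun i => ?_) (fun t ht => ?_)
  · rw [hcurve, ← numRegions_eq_encard, ← numRegions_eq_encard] at h
    refine h.trans (le_of_eq ?_)
    congr 5
    ext i
    exact ⟨fun ⟨t, ht, htA⟩ => ⟨_, ⟨t, ht, rfl⟩, htA⟩, fun ⟨_, ⟨t, ht, rfl⟩, htA⟩ => ⟨t, ht, htA⟩⟩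
  · refine hI.inter (Convex.ordConnected ?_)
    have : (fun t : ℝ => p + t • d) = AffineMap.lineMap p (p + d) := by
      ext t; simp [AffineMap.lineMap_apply, add_comm]
    rw [this]
    exact (hA i).affine_preimage _
  · rw [hcurve]
    have h1 := Set.ext_iff.1 hcov (p + t • d)
    have h2 : p + t • d ∈ (fun t : ℝ => p + t • d) '' I := ⟨t, ht, rfl⟩
    simpa [h2, ht, -Set.mem_image] using h1

/-- The circle is cut at a point `w` that already belongs to `K`. What is left is an open arc with
one intersection point fewer, and this cancels the `+ 1` of the arc bound. -/
theorem numRegions_union_circle_le {K : Set Plane} (hK : IsClosed K) (c : Plane) {r : ℝ}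
    (hr : 0 < r) (hfin : (Metric.sphere c r ∩ K).Finite) (hne : (Metric.sphere c r ∩ K).Nonempty) :
    numRegions (K ∪ Metric.sphere c r) ≤ numRegions K + (Metric.sphere c r ∩ K).ncard := by
  obtain ⟨w, hw, hwK⟩ := hne
  set u := c - w with hu
  have hnu : ‖u‖ = r := by rw [hu, norm_sub_rev]; exact mem_sphere_iff_norm.1 hw
  have hu0 : u ≠ 0 := by rw [← norm_pos_iff, hnu]; exact hr
  have himg := circleChart_image c u hu0
  rw [hnu, show c - u = w from sub_sub_cancel c w] at himg
  have hun : K ∪ (Metric.sphere c r \ {w}) = K ∪ Metric.sphere c r := by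
    ext z
    by_cases hz : z = w
    · simp [hz, hwK]
    · simp [hz]
  have : Finite ↥((Metric.sphere c r ∩ K) \ {w}) := (hfin.subset Set.sdiff_subset).to_subtype
  have h := (circleChart c u hu0).encard_components_union_le isOpen_Ioo Set.ordConnected_Ioo hK
    (by rw [himg, hun]; exact hK.union Metric.isClosed_sphere)
    (ι := ↥((Metric.sphere c r ∩ K) \ {w}))
    (fun x => {t ∈ Set.Ioo (-Real.pi) Real.pi | (circleChart c u hu0).curve t = x})
    (fun x => ?_) (fun t ht => ?_)
  · rw [himg, hun, ← numRegions_eq_encard, ← numRegions_eq_encard] at h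
    refine h.trans ?_
    gcongr
    refine (Nat.add_le_add_right (Set.ncard_le_card _) 1).trans ?_
    rw [Nat.card_coe_set_eq, Set.ncard_sdiff_singleton_add_one
      (show w ∈ Metric.sphere c r ∩ K from ⟨hw, hwK⟩) hfin]
  · refine Set.ordConnected_iff.2 ?_
    rintro s ⟨hs, hs'⟩ t ⟨ht, ht'⟩ -
    have hst : s = t := by
      rw [← (circleChart c u hu0).param_curve hs, hs', ← ht', (circleChart c u hu0).param_curve ht]
    rw [hst, Set.Icc_self, Set.singleton_subset_iff]
    exact ⟨ht, ht'⟩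
  · have hmem : (circleChart c u hu0).curve t ∈ Metric.sphere c r \ {w} := by
      rw [← himg]; exact ⟨t, ht, rfl⟩
    constructor
    · intro h
      exact ⟨⟨_, ⟨hmem.1, h⟩, hmem.2⟩, ht, rfl⟩
    · rintro ⟨⟨x, hx⟩, -, h⟩
      rw [h]
      exact hx.1.2

/-! ### Upper bounds for H figures. -/

/-- The line through `p` perpendicular to `d`. -/
def perpLine (p d : Plane) : Set Plane := {x | inner ℝ (x - p) d = 0}

theorem perpLine_eq_image (p : Plane) {d : Plane} (hd : d ≠ 0) :
    perpLine p d = (fun t : ℝ => p + t • rot d) '' Set.univ := by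
  have h3 : d 0 ^ 2 + d 1 ^ 2 ≠ 0 := (plane_ne_zero_iff.1 hd).ne'
  ext x
  simp only [perpLine, Set.mem_ofPred_eq, inner_plane, Set.mem_image, Set.mem_univ, true_and,
    PiLp.sub_apply]
  constructor
  · intro h
    refine ⟨((x 1 - p 1) * d 0 - (x 0 - p 0) * d 1) / (d 0 ^ 2 + d 1 ^ 2), ?_⟩
    apply plane_ext
    · simp only [PiLp.add_apply, PiLp.smul_apply, smul_eq_mul, rot_zero]
      field_simp
      linear_combination (-d 0) * h
    · simp only [PiLp.add_apply, PiLp.smul_apply, smul_eq_mul, rot_one]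
      field_simp
      linear_combination (-d 1) * h
  · rintro ⟨t, rfl⟩
    simp
    ring

theorem convex_perpLine (p d : Plane) : Convex ℝ (perpLine p d) := by
  intro x hx y hy a b _ _ hab
  simp only [perpLine, Set.mem_ofPred_eq, inner_plane, PiLp.sub_apply, PiLp.add_apply,
    PiLp.smul_apply, smul_eq_mul] at *
  linear_combination a * hx + b * hy + (p 0 * d 0 + p 1 * d 1) * hab

theorem isClosed_perpLine (p d : Plane) : IsClosed (perpLine p d) :=
  isClosed_eq (by fun_prop) continuous_const

theorem openSegment_eq_image_smul (p q : Plane) :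
    openSegment ℝ p q = (fun t : ℝ => p + t • (q - p)) '' Set.Ioo 0 1 :=
  openSegment_eq_image' ℝ p q

/-- The two lines and the open crossbar of an `hFigure`. -/
def hPiece (p q : Plane) : Fin 3 → Set Plane :=
  ![perpLine p (q - p), perpLine q (q - p), openSegment ℝ p q]

theorem convex_hPiece (p q : Plane) (a : Fin 3) : Convex ℝ (hPiece p q a) := by
  fin_cases a
  · exact convex_perpLine _ _
  · exact convex_perpLine _ _
  · exact convex_openSegment _ _

theorem hFigure_eq_union (p q : Plane) :
    hFigure p q = perpLine p (q - p) ∪ perpLine q (q - p) ∪ openSegment ℝ p q := by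
  rw [hFigure, ← insert_endpoints_openSegment]
  change perpLine p (q - p) ∪ perpLine q (q - p) ∪ _ = _
  ext x
  have hp : p ∈ perpLine p (q - p) := by simp [perpLine]
  have hq : q ∈ perpLine q (q - p) := by simp [perpLine]
  simp only [Set.mem_union, Set.mem_insert_iff]
  constructor
  · rintro (h | rfl | rfl | h)
    · exact Or.inl h
    · exact Or.inl (Or.inl hp)
    · exact Or.inl (Or.inr hq)
    · exact Or.inr h
  · tauto

theorem hFigure_eq_iUnion (p q : Plane) : hFigure p q = ⋃ a, hPiece p q a := by
  rw [hFigure_eq_union]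
  ext x
  simp [Fin.exists_fin_succ, hPiece, or_assoc]

theorem isClosed_hFigure (p q : Plane) : IsClosed (hFigure p q) := by
  have h : IsClosed (segment ℝ p q) := by
    rw [← convexHull_pair]
    exact (Set.toFinite {p, q}).isClosed_convexHull ℝ
  exact ((isClosed_perpLine p (q - p)).union (isClosed_perpLine q (q - p))).union h

/-- An open crossbar running between two lines that the other crossbar meets both cannot meet both
the other crossbar and one of its lines: the scalar form of this fact. -/
theorem crossbar_aux {D D' g t t₀ t₁ t₂ u₀ : ℝ} (hD : 0 < D) (hg : g ^ 2 ≤ D * D')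
    (ht : 0 < t ∧ t < 1) (ht₁ : 0 < t₁ ∧ t₁ < 1) (ht₂ : 0 < t₂ ∧ t₂ < 1)
    (hu₀ : 0 < u₀ ∧ u₀ < 1)
    (h₁ : (t₁ - u₀) * g = -t₀ * D) (h₂ : (t₂ - u₀) * g = (1 - t₀) * D)
    (h : (t - t₀) * g = -u₀ * D' ∨ (t - t₀) * g = (1 - u₀) * D') : False := by
  -- `D`, `D'` are the squared lengths of the crossbars, `g` their inner product, and `t₀`, `u₀` the
  -- parameters of their common point. In each case `h₁` or `h₂` bounds the distance from `t₀` to an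
  -- end of the first crossbar, while `h` with `hg` forces `t` to lie beyond that end.
  have hg0 : g ≠ 0 := by
    rintro rfl
    nlinarith
  rcases lt_or_gt_of_ne hg0 with hneg | hpos
  · rcases h with h | h
    · have e1 : (1 - t₀) * D < u₀ * (-g) := by nlinarith
      have e2 : (t - t₀) * D ≥ u₀ * (-g) := by
        by_contra hc
        push Not at hc
        have := mul_lt_mul_of_pos_right hc (neg_pos.2 hneg)
        nlinarith
      nlinarith
    · have e1 : t₀ * D < (1 - u₀) * (-g) := by nlinarith
      have e2 : (t₀ - t) * D ≥ (1 - u₀) * (-g) := by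
        by_contra hc
        push Not at hc
        have := mul_lt_mul_of_pos_right hc (neg_pos.2 hneg)
        nlinarith
      nlinarith
  · rcases h with h | h
    · have e1 : t₀ * D < u₀ * g := by nlinarith
      have e2 : (t₀ - t) * D ≥ u₀ * g := by
        by_contra hc
        push Not at hc
        have := mul_lt_mul_of_pos_right hc hpos
        nlinarith
      nlinarith
    · have e1 : (1 - t₀) * D < (1 - u₀) * g := by nlinarith
      have e2 : (t - t₀) * D ≥ (1 - u₀) * g := by
        by_contra hc
        push Not at hc
        have := mul_lt_mul_of_pos_right hc hpos
        nlinarith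
      nlinarith

section
variable {p q p' q' : Plane}

/-- Both lines of the first figure meet the second crossbar, which meets the first crossbar; then
the first crossbar misses the lines of the second figure. -/
theorem not_crossbars_cross (hpq : p ≠ q) (hpq' : p' ≠ q')
    (h₁ : (perpLine p (q - p) ∩ openSegment ℝ p' q').Nonempty)
    (h₂ : (perpLine q (q - p) ∩ openSegment ℝ p' q').Nonempty)
    (h₃ : (openSegment ℝ p q ∩ openSegment ℝ p' q').Nonempty) :
    ¬ (openSegment ℝ p q ∩ perpLine p' (q' - p')).Nonempty ∧
    ¬ (openSegment ℝ p q ∩ perpLine q' (q' - p')).Nonempty := by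
  have hD := plane_ne_zero_iff.1 (sub_ne_zero.2 hpq.symm)
  have hD' := plane_ne_zero_iff.1 (sub_ne_zero.2 hpq'.symm)
  rw [openSegment_eq_image_smul p' q'] at h₁ h₂ h₃
  rw [openSegment_eq_image_smul p q] at *
  obtain ⟨_, h₁, t₁, ht₁, rfl⟩ := h₁
  obtain ⟨_, h₂, t₂, ht₂, rfl⟩ := h₂
  obtain ⟨_, ⟨t₀, ht₀, rfl⟩, u₀, hu₀, h₀⟩ := h₃
  have h₀0 := congrArg (fun x : Plane => x 0) h₀
  have h₀1 := congrArg (fun x : Plane => x 1) h₀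
  simp only [perpLine, Set.mem_ofPred_eq, inner_plane, PiLp.sub_apply, PiLp.add_apply,
    PiLp.smul_apply, smul_eq_mul] at h₁ h₂ h₀0 h₀1 hD hD'
  set g := (q 0 - p 0) * (q' 0 - p' 0) + (q 1 - p 1) * (q' 1 - p' 1) with hg
  have hcs : g ^ 2 ≤ ((q 0 - p 0) ^ 2 + (q 1 - p 1) ^ 2) *
      ((q' 0 - p' 0) ^ 2 + (q' 1 - p' 1) ^ 2) := by
    rw [hg]
    nlinarith [sq_nonneg ((q 0 - p 0) * (q' 1 - p' 1) - (q 1 - p 1) * (q' 0 - p' 0))]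
  constructor
  · rintro ⟨_, ⟨t, ht, rfl⟩, h⟩
    simp only [perpLine, Set.mem_ofPred_eq, inner_plane, PiLp.sub_apply, PiLp.add_apply,
      PiLp.smul_apply, smul_eq_mul] at h
    refine crossbar_aux (t₀ := t₀) hD hcs ht ht₁ ht₂ hu₀ ?_ ?_ (Or.inl ?_)
    · rw [hg]; linear_combination h₁ - (q 0 - p 0) * h₀0 - (q 1 - p 1) * h₀1
    · rw [hg]; linear_combination h₂ - (q 0 - p 0) * h₀0 - (q 1 - p 1) * h₀1
    · rw [hg]; linear_combination h + (q' 0 - p' 0) * h₀0 + (q' 1 - p' 1) * h₀1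
  · rintro ⟨_, ⟨t, ht, rfl⟩, h⟩
    simp only [perpLine, Set.mem_ofPred_eq, inner_plane, PiLp.sub_apply, PiLp.add_apply,
      PiLp.smul_apply, smul_eq_mul] at h
    refine crossbar_aux (t₀ := t₀) hD hcs ht ht₁ ht₂ hu₀ ?_ ?_ (Or.inr ?_)
    · rw [hg]; linear_combination h₁ - (q 0 - p 0) * h₀0 - (q 1 - p 1) * h₀1
    · rw [hg]; linear_combination h₂ - (q 0 - p 0) * h₀0 - (q 1 - p 1) * h₀1
    · rw [hg]; linear_combination h + (q' 0 - p' 0) * h₀0 + (q' 1 - p' 1) * h₀1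

/-- The open second crossbar reaches both lines of the first figure, so its projection on the first
crossbar's direction is strictly longer than the first crossbar. -/
theorem sq_lt_inner_sq_of_crossbar (hpq : p ≠ q)
    (h₁ : (perpLine p (q - p) ∩ openSegment ℝ p' q').Nonempty)
    (h₂ : (perpLine q (q - p) ∩ openSegment ℝ p' q').Nonempty) :
    ‖q - p‖ ^ 2 < |inner ℝ (q - p) (q' - p')| := by
  have hD := plane_ne_zero_iff.1 (sub_ne_zero.2 hpq.symm)
  rw [openSegment_eq_image_smul p' q'] at h₁ h₂
  obtain ⟨_, h₁, t₁, ht₁, rfl⟩ := h₁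
  obtain ⟨_, h₂, t₂, ht₂, rfl⟩ := h₂
  simp only [perpLine, Set.mem_ofPred_eq, inner_plane, norm_sq_plane, PiLp.sub_apply,
    PiLp.add_apply, PiLp.smul_apply, smul_eq_mul] at *
  set g := (q 0 - p 0) * (q' 0 - p' 0) + (q 1 - p 1) * (q' 1 - p' 1) with hg
  have h : (t₂ - t₁) * g = (q 0 - p 0) ^ 2 + (q 1 - p 1) ^ 2 := by
    rw [hg]; linear_combination h₂ - h₁
  rw [← h] at hD ⊢
  have ht : |t₂ - t₁| < 1 := abs_lt.2 ⟨by linarith [ht₁.2, ht₂.1], by linarith [ht₁.1, ht₂.2]⟩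
  have hg0 : 0 < |g| := abs_pos.2 (by rintro h0; simp [h0] at hD)
  calc (t₂ - t₁) * g ≤ |(t₂ - t₁) * g| := le_abs_self _
    _ = |t₂ - t₁| * |g| := abs_mul _ _
    _ < |g| := by nlinarith

/-- By Cauchy–Schwarz the projection is at most the length, so each crossbar would be strictly
longer than the other. -/
theorem not_crossbars_span (hpq : p ≠ q) (hpq' : p' ≠ q')
    (h₁ : (perpLine p (q - p) ∩ openSegment ℝ p' q').Nonempty)
    (h₂ : (perpLine q (q - p) ∩ openSegment ℝ p' q').Nonempty)
    (h₃ : (openSegment ℝ p q ∩ perpLine p' (q' - p')).Nonempty)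
    (h₄ : (openSegment ℝ p q ∩ perpLine q' (q' - p')).Nonempty) : False := by
  rw [Set.inter_comm] at h₃ h₄
  have e1 := sq_lt_inner_sq_of_crossbar hpq h₁ h₂
  have e2 := sq_lt_inner_sq_of_crossbar hpq' h₃ h₄
  rw [real_inner_comm] at e2
  have e3 := abs_real_inner_le_norm (q - p) (q' - p')
  have := norm_pos_iff.2 (sub_ne_zero.2 hpq.symm)
  have := norm_pos_iff.2 (sub_ne_zero.2 hpq'.symm)
  rcases le_total ‖q - p‖ ‖q' - p'‖ with h | h <;> nlinarith

/-- At most seven of the nine pairs of pieces of two figures meet. -/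
theorem card_hPiece_inter_le (hpq : p ≠ q) (hpq' : p' ≠ q') :
    {x : Fin 3 × Fin 3 | (hPiece p q x.1 ∩ hPiece p' q' x.2).Nonempty}.ncard ≤ 7 := by
  have hA := not_crossbars_span hpq hpq'
  have hB := not_crossbars_cross hpq hpq'
  have hB' := not_crossbars_cross hpq' hpq
  simp only [Set.inter_comm (perpLine _ (q' - p')), Set.inter_comm (openSegment ℝ p' q')] at hB'
  have key : ∃ x y : Fin 3 × Fin 3, x ≠ y ∧ ¬ (hPiece p q x.1 ∩ hPiece p' q' x.2).Nonempty ∧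
      ¬ (hPiece p q y.1 ∩ hPiece p' q' y.2).Nonempty := by
    -- The four line–line pairs may all meet. Two failures are sought among the pairs `(0, 2)`, `(1,
    -- 2)`, `(2, 0)`, `(2, 1)`, `(2, 2)` that involve a crossbar.
    by_cases h₁ : (perpLine p (q - p) ∩ openSegment ℝ p' q').Nonempty
    · by_cases h₂ : (perpLine q (q - p) ∩ openSegment ℝ p' q').Nonempty
      · by_cases h₃ : (openSegment ℝ p q ∩ perpLine p' (q' - p')).Nonempty
        · exact ⟨(2, 1), (2, 2), by decide, fun h => hA h₁ h₂ h₃ h, fun h => (hB h₁ h₂ h).1 h₃⟩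
        · by_cases h₅ : (openSegment ℝ p q ∩ openSegment ℝ p' q').Nonempty
          · exact ⟨(2, 0), (2, 1), by decide, h₃, (hB h₁ h₂ h₅).2⟩
          · exact ⟨(2, 0), (2, 2), by decide, h₃, h₅⟩
      · by_cases h₃ : (openSegment ℝ p q ∩ perpLine p' (q' - p')).Nonempty
        · by_cases h₄ : (openSegment ℝ p q ∩ perpLine q' (q' - p')).Nonempty
          · exact ⟨(1, 2), (2, 2), by decide, h₂, fun h => (hB' h₃ h₄ h).1 h₁⟩
          · exact ⟨(1, 2), (2, 1), by decide, h₂, h₄⟩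
        · exact ⟨(1, 2), (2, 0), by decide, h₂, h₃⟩
    · by_cases h₂ : (perpLine q (q - p) ∩ openSegment ℝ p' q').Nonempty
      · by_cases h₃ : (openSegment ℝ p q ∩ perpLine p' (q' - p')).Nonempty
        · by_cases h₄ : (openSegment ℝ p q ∩ perpLine q' (q' - p')).Nonempty
          · exact ⟨(0, 2), (2, 2), by decide, h₁, fun h => (hB' h₃ h₄ h).2 h₂⟩
          · exact ⟨(0, 2), (2, 1), by decide, h₁, h₄⟩
        · exact ⟨(0, 2), (2, 0), by decide, h₁, h₃⟩
      · exact ⟨(0, 2), (1, 2), by decide, h₁, h₂⟩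
  obtain ⟨x, y, hxy, hx, hy⟩ := key
  have h1 : {x : Fin 3 × Fin 3 | (hPiece p q x.1 ∩ hPiece p' q' x.2).Nonempty} ⊆
      ({x, y} : Set (Fin 3 × Fin 3))ᶜ := by
    rintro z hz (rfl | rfl)
    · exact hx hz
    · exact hy hz
  refine (Set.ncard_le_ncard h1 (Set.toFinite _)).trans ?_
  rw [Set.ncard_compl, Set.ncard_pair hxy]
  simp

end

theorem Convex.subsingleton_of_finite {s : Set Plane} (hs : Convex ℝ s) (hf : s.Finite) :
    s.Subsingleton := by
  by_contra h
  rw [Set.not_subsingleton_iff] at h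
  exact hs.isPreconnected.infinite_of_nontrivial h hf

/-- Two pieces meet in a convex set, which has at most one point when it is finite; so the common
points inject into the pairs of pieces that meet. -/
theorem encard_hFigure_inter_le {p q p' q' : Plane} (hpq : p ≠ q) (hpq' : p' ≠ q')
    (hfin : (hFigure p q ∩ hFigure p' q').Finite) :
    (hFigure p q ∩ hFigure p' q').encard ≤ 7 := by
  have hex : ∀ x : Plane, ∃ ab : Fin 3 × Fin 3, x ∈ hFigure p q ∩ hFigure p' q' →
      x ∈ hPiece p q ab.1 ∩ hPiece p' q' ab.2 := by
    intro x
    by_cases hx : x ∈ hFigure p q ∩ hFigure p' q'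
    · have h1 := hx.1
      have h2 := hx.2
      rw [hFigure_eq_iUnion, Set.mem_iUnion] at h1 h2
      obtain ⟨a, ha⟩ := h1
      obtain ⟨b, hb⟩ := h2
      exact ⟨(a, b), fun _ => ⟨ha, hb⟩⟩
    · exact ⟨0, fun h => absurd h hx⟩
  choose f hf using hex
  have hsub : ∀ a b, (hPiece p q a ∩ hPiece p' q' b).Subsingleton := fun a b =>
    ((convex_hPiece p q a).inter (convex_hPiece p' q' b)).subsingleton_of_finite
      (hfin.subset (by
        rw [hFigure_eq_iUnion, hFigure_eq_iUnion]
        exact Set.inter_subset_inter (Set.subset_iUnion _ a) (Set.subset_iUnion _ b)))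
  have h1 := Set.encard_le_encard_of_injOn (f := f) (s := hFigure p q ∩ hFigure p' q')
    (t := {x : Fin 3 × Fin 3 | (hPiece p q x.1 ∩ hPiece p' q' x.2).Nonempty})
    (fun x hx => ⟨x, hf x hx⟩)
    (fun x hx y hy hxy => hsub _ _ (hf x hx) (hxy ▸ hf y hy))
  refine h1.trans ?_
  rw [← (Set.toFinite _).cast_ncard_eq]
  exact_mod_cast card_hPiece_inter_le hpq hpq'

theorem numRegions_empty : numRegions ∅ = 1 := by
  rw [numRegions_eq_encard, components, Set.compl_empty]
  have : connectedComponentIn (Set.univ : Set Plane) = fun _ => Set.univ := by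
    ext1 x
    rw [connectedComponentIn_univ]
    exact PreconnectedSpace.connectedComponent_eq_univ x
  rw [this, Set.Nonempty.image_const Set.univ_nonempty, Set.encard_singleton]

theorem isClosed_of_isConstrainedH {S : Set Plane} (h : IsConstrainedH S) : IsClosed S := by
  obtain ⟨p, q, -, rfl⟩ := h
  exact isClosed_hFigure p q

open Classical in
theorem ncard_prod_eq_sum {n : ℕ} (P : Fin n × Fin 3 → Prop) :
    {x | P x}.ncard = ∑ i, ∑ b, if P (i, b) then 1 else 0 := by
  rw [Set.ncard_eq_toFinset_card', Set.toFinset_ofPred, Finset.card_filter,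
    Fintype.sum_prod_type]

theorem rot_ne_zero {d : Plane} (hd : d ≠ 0) : rot d ≠ 0 := by
  rw [← norm_pos_iff, norm_rot]
  exact norm_pos_iff.2 hd

theorem disjoint_perpLine {p q : Plane} (hpq : p ≠ q) :
    Disjoint (perpLine p (q - p)) (perpLine q (q - p)) := by
  have hD := plane_ne_zero_iff.1 (sub_ne_zero.2 hpq.symm)
  refine Set.disjoint_left.2 fun x h1 h2 => ?_
  simp only [perpLine, Set.mem_ofPred_eq, inner_plane, PiLp.sub_apply] at h1 h2 hD
  nlinarith

theorem disjoint_perpLine_openSegment {p q : Plane} (hpq : p ≠ q) :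
    Disjoint (perpLine p (q - p) ∪ perpLine q (q - p)) (openSegment ℝ p q) := by
  have hD := plane_ne_zero_iff.1 (sub_ne_zero.2 hpq.symm)
  rw [openSegment_eq_image_smul]
  refine Set.disjoint_left.2 ?_
  rintro _ (h | h) ⟨t, ht, rfl⟩
  · simp only [perpLine, Set.mem_ofPred_eq, inner_plane, PiLp.sub_apply, PiLp.add_apply,
      PiLp.smul_apply, smul_eq_mul] at h hD
    have : t * ((q 0 - p 0) ^ 2 + (q 1 - p 1) ^ 2) = 0 := by linear_combination h
    exact (mul_pos ht.1 hD).ne' this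
  · simp only [perpLine, Set.mem_ofPred_eq, inner_plane, PiLp.sub_apply, PiLp.add_apply,
      PiLp.smul_apply, smul_eq_mul] at h hD
    have : (1 - t) * ((q 0 - p 0) ^ 2 + (q 1 - p 1) ^ 2) = 0 := by linear_combination -h
    exact (mul_pos (sub_pos.2 ht.2) hD).ne' this

open Classical in
-- The two lines and the open crossbar are disjoint, so each piece when added meets only the old
-- figures. The three steps give `+ 3`, and every old figure accounts for at most seven pairs of
-- pieces.
theorem numRegions_union_hFigure_le {n : ℕ} (S : Fin n → Set Plane)
    (hS : ∀ i, IsConstrainedH (S i)) {p q : Plane} (hpq : p ≠ q) :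
    numRegions ((⋃ i, S i) ∪ hFigure p q) ≤ numRegions (⋃ i, S i) + (7 * n + 3 : ℕ) := by
  have hK : IsClosed (⋃ i, S i) :=
    isClosed_iUnion_of_finite fun i => isClosed_of_isConstrainedH (hS i)
  choose p' q' hpq' hS' using hS
  set K := ⋃ i, S i with hKdef
  have hKA : K = ⋃ x : Fin n × Fin 3, hPiece (p' x.1) (q' x.1) x.2 := by
    rw [hKdef, Set.iUnion_prod']
    exact Set.iUnion_congr fun i => by rw [hS', hFigure_eq_iUnion]
  have hd : q - p ≠ 0 := sub_ne_zero.2 hpq.symm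
  set L₁ := perpLine p (q - p) with hL₁
  set L₂ := perpLine q (q - p) with hL₂
  set B := openSegment ℝ p q with hB
  have hL₁c : IsClosed L₁ := isClosed_perpLine _ _
  have hL₂c : IsClosed L₂ := isClosed_perpLine _ _
  have hfig : K ∪ hFigure p q = K ∪ L₁ ∪ L₂ ∪ B := by
    rw [hFigure_eq_union, ← Set.union_assoc, ← Set.union_assoc]
  have hL₁i := perpLine_eq_image p hd
  have hL₂i := perpLine_eq_image q hd
  have hBi := openSegment_eq_image_smul p q
  rw [← hL₁] at hL₁i
  rw [← hL₂] at hL₂i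
  rw [← hB] at hBi
  have hA : ∀ x : Fin n × Fin 3, Convex ℝ (hPiece (p' x.1) (q' x.1) x.2) :=
    fun x => convex_hPiece _ _ _
  have s1 := numRegions_union_line_le hK p (rot (q - p)) (rot_ne_zero hd) isOpen_univ
    Set.ordConnected_univ (by rw [← hL₁i]; exact hK.union hL₁c) _ hA (by rw [← hKA])
  rw [← hL₁i] at s1
  have s2 := numRegions_union_line_le (hK.union hL₁c) q (rot (q - p)) (rot_ne_zero hd) isOpen_univ
    Set.ordConnected_univ (by rw [← hL₂i]; exact (hK.union hL₁c).union hL₂c) _ hA (by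
      rw [← hKA, ← hL₂i, Set.inter_union_distrib_left,
        (disjoint_perpLine hpq).symm.inter_eq, Set.union_empty])
  rw [← hL₂i] at s2
  have s3 := numRegions_union_line_le ((hK.union hL₁c).union hL₂c) p (q - p) hd
    (isOpen_Ioo (a := 0) (b := 1)) Set.ordConnected_Ioo (by
      rw [← hBi, ← hfig]; exact hK.union (isClosed_hFigure p q)) _ hA (by
      rw [← hKA, ← hBi, Set.union_assoc, Set.inter_union_distrib_left,
        (disjoint_perpLine_openSegment hpq).symm.inter_eq, Set.union_empty])
  rw [← hBi] at s3
  rw [hfig]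
  refine s3.trans ((add_le_add_left (s2.trans (add_le_add_left s1 _)) _).trans ?_)
  rw [add_assoc, add_assoc]
  gcongr
  norm_cast
  rw [ncard_prod_eq_sum, ncard_prod_eq_sum, ncard_prod_eq_sum]
  have hsum : ∀ i, ((∑ b, if (L₁ ∩ hPiece (p' i) (q' i) b).Nonempty then 1 else 0) +
      (∑ b, if (L₂ ∩ hPiece (p' i) (q' i) b).Nonempty then 1 else 0) +
      (∑ b, if (B ∩ hPiece (p' i) (q' i) b).Nonempty then 1 else 0)) ≤ 7 := by
    intro i
    have h := card_hPiece_inter_le hpq (hpq' i)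
    rw [ncard_prod_eq_sum, Fin.sum_univ_three] at h
    exact h
  have htot := Finset.sum_le_sum fun i (_ : i ∈ Finset.univ) => hsum i
  simp only [Finset.sum_add_distrib, Finset.sum_const, Finset.card_univ, Fintype.card_fin,
    smul_eq_mul] at htot
  dsimp only
  omega

theorem iUnion_fin_succ (n : ℕ) (S : Fin (n + 1) → Set Plane) :
    ⋃ i, S i = (⋃ i : Fin n, S i.castSucc) ∪ S (Fin.last n) := by
  ext x
  simp only [Set.mem_iUnion, Set.mem_union]
  exact Fin.exists_fin_succ'

theorem regionNumber_succ (n : ℕ) :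
    (7 * (n + 1) ^ 2 - (n + 1) + 2) / 2 = (7 * n ^ 2 - n + 2) / 2 + (7 * n + 3) := by
  -- This keeps the subtraction of natural numbers from truncating.
  have h1 : n ≤ 7 * n ^ 2 := by nlinarith [Nat.le_self_pow (two_ne_zero) n]
  have h2 : 7 * (n + 1) ^ 2 - (n + 1) + 2 = 7 * n ^ 2 - n + 2 + (7 * n + 3) * 2 := by
    have : 7 * (n + 1) ^ 2 = 7 * n ^ 2 + 14 * n + 7 := by ring
    omega
  rw [h2, Nat.add_mul_div_right _ _ two_pos]

theorem numRegions_iUnion_le (shape : Set Plane → Prop)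
    (hstep : ∀ (n : ℕ) (S : Fin n → Set Plane), (∀ i, shape (S i)) → ∀ T, shape T →
      numRegions ((⋃ i, S i) ∪ T) ≤ numRegions (⋃ i, S i) + (7 * n + 3 : ℕ))
    (n : ℕ) (S : Fin n → Set Plane) (hS : ∀ i, shape (S i)) :
    numRegions (⋃ i, S i) ≤ ((7 * n ^ 2 - n + 2) / 2 : ℕ) := by
  induction n with
  | zero => simp [numRegions_empty]
  | succ n ih =>
    rw [iUnion_fin_succ, regionNumber_succ, Nat.cast_add]
    exact (hstep n _ (fun i => hS _) _ (hS _)).trans (add_le_add_left (ih _ fun i => hS _) _)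

theorem le_numRegions_iUnion (S : ℕ → Set Plane)
    (hstep : ∀ n : ℕ, numRegions (⋃ i : Fin n, S i) + (7 * n + 3 : ℕ) ≤
      numRegions ((⋃ i : Fin n, S i) ∪ S n)) (n : ℕ) :
    ((7 * n ^ 2 - n + 2) / 2 : ℕ) ≤ numRegions (⋃ i : Fin n, S i) := by
  induction n with
  | zero => simp [numRegions_empty]
  | succ n ih =>
    rw [iUnion_fin_succ, regionNumber_succ, Nat.cast_add]
    exact (add_le_add_left ih _).trans (hstep n)

/-- The maximum is reduced to two statements about a single step: every figure adds at most `7 * n +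
3` regions, and one fixed sequence adds at least that many each time. -/
theorem isGreatest_regionCounts (shape : Set Plane → Prop)
    (hle : ∀ (n : ℕ) (S : Fin n → Set Plane), (∀ i, shape (S i)) → ∀ T, shape T →
      numRegions ((⋃ i, S i) ∪ T) ≤ numRegions (⋃ i, S i) + (7 * n + 3 : ℕ))
    (S : ℕ → Set Plane) (hS : ∀ i, shape (S i))
    (hge : ∀ n : ℕ, numRegions (⋃ i : Fin n, S i) + (7 * n + 3 : ℕ) ≤
      numRegions ((⋃ i : Fin n, S i) ∪ S n)) (n : ℕ) :
    IsGreatest (regionCounts shape n) (((7 * n ^ 2 - n + 2) / 2 : ℕ) : ℕ∞) := by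
  refine ⟨⟨fun i => S i, fun i => hS _, le_antisymm (le_numRegions_iUnion S hge n)
    (numRegions_iUnion_le shape hle n _ fun i => hS _)⟩, ?_⟩
  rintro _ ⟨T, hT, rfl⟩
  exact numRegions_iUnion_le shape hle n T hT

theorem numRegions_union_constrainedH_le (n : ℕ) (S : Fin n → Set Plane)
    (hS : ∀ i, IsConstrainedH (S i)) (T : Set Plane) (hT : IsConstrainedH T) :
    numRegions ((⋃ i, S i) ∪ T) ≤ numRegions (⋃ i, S i) + (7 * n + 3 : ℕ) := by
  obtain ⟨p, q, hpq, rfl⟩ := hT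
  exact numRegions_union_hFigure_le S hS hpq

/-! ### Upper bounds for φ figures. -/

theorem encard_le_two {α : Type*} {s : Set α}
    (h : ∀ a ∈ s, ∀ b ∈ s, ∀ c ∈ s, a ≠ b → a ≠ c → b ≠ c → False) : s.encard ≤ 2 := by
  by_contra hc
  push Not at hc
  obtain ⟨t, hts, ht⟩ := Set.exists_subset_encard_eq (show (3 : ℕ∞) ≤ s.encard from
    Order.add_one_le_of_lt hc)
  obtain ⟨a, b, c, hab, hac, hbc, rfl⟩ := Set.encard_eq_three.1 ht
  exact h a (hts (by simp)) b (hts (by simp)) c (hts (by simp)) hab hac hbc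

theorem encard_inter_iUnion_le {n : ℕ} (A : Set Plane) (S : Fin n → Set Plane) (k : ℕ)
    (h : ∀ i, (A ∩ S i).encard ≤ k) : (A ∩ ⋃ i, S i).encard ≤ (n * k : ℕ) := by
  induction n with
  | zero => simp
  | succ n ih =>
    rw [iUnion_fin_succ, Set.inter_union_distrib_left]
    refine (Set.encard_union_le _ _).trans ?_
    rw [Nat.succ_mul, Nat.cast_add]
    exact add_le_add (ih _ fun i => h _) (h _)

/-- The line through `c` with direction `u`. -/
def lineThrough (c u : Plane) : Set Plane := Set.range fun t : ℝ => c + t • u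

theorem lineThrough_eq_image (c u : Plane) :
    lineThrough c u = (fun t : ℝ => c + t • u) '' Set.univ := Set.image_univ.symm

theorem mem_lineThrough_iff {c u : Plane} (hu : u ≠ 0) {x : Plane} :
    x ∈ lineThrough c u ↔ (x 1 - c 1) * u 0 = (x 0 - c 0) * u 1 := by
  have h3 := (plane_ne_zero_iff.1 hu).ne'
  constructor
  · rintro ⟨t, rfl⟩
    simp
    ring
  · intro h
    refine ⟨((x 0 - c 0) * u 0 + (x 1 - c 1) * u 1) / (u 0 ^ 2 + u 1 ^ 2), ?_⟩
    apply plane_ext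
    · simp only [PiLp.add_apply, PiLp.smul_apply, smul_eq_mul]
      field_simp
      linear_combination u 1 * h
    · simp only [PiLp.add_apply, PiLp.smul_apply, smul_eq_mul]
      field_simp
      linear_combination (-u 0) * h

theorem isClosed_lineThrough {c u : Plane} (hu : u ≠ 0) : IsClosed (lineThrough c u) := by
  have : lineThrough c u = {x : Plane | (x 1 - c 1) * u 0 = (x 0 - c 0) * u 1} :=
    Set.ext fun x => mem_lineThrough_iff hu
  rw [this]
  exact isClosed_eq (by fun_prop) (by fun_prop)

theorem injective_lineThrough (c : Plane) {u : Plane} (hu : u ≠ 0) :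
    Function.Injective fun t : ℝ => c + t • u :=
  fun _ _ h => smul_left_injective ℝ hu (add_left_cancel h)

theorem infinite_lineThrough (c : Plane) {u : Plane} (hu : u ≠ 0) : (lineThrough c u).Infinite :=
  Set.infinite_range_of_injective (injective_lineThrough c hu)

theorem infinite_sphere (c : Plane) {r : ℝ} (hr : 0 < r) : (Metric.sphere c r).Infinite := by
  have hu : (!₂[r, 0] : Plane) ≠ 0 := plane_ne_zero_iff.2 (by simp; positivity)
  have hn : ‖(!₂[r, 0] : Plane)‖ = r := by
    rw [← sq_eq_sq₀ (norm_nonneg _) hr.le, norm_sq_plane]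
    simp
  have h := circleChart_image c _ hu
  rw [hn] at h
  refine Set.Infinite.mono (h.subset.trans Set.sdiff_subset) ?_
  refine (Set.Ioo_infinite (by linarith [Real.pi_pos])).image fun s hs t ht hst => ?_
  rw [← (circleChart c _ hu).param_curve hs, hst, (circleChart c _ hu).param_curve ht]

theorem encard_line_inter_line_le {c u c' u' : Plane} (hu' : u' ≠ 0)
    (h : ¬ lineThrough c u ⊆ lineThrough c' u') :
    (lineThrough c u ∩ lineThrough c' u').encard ≤ 1 := by
  rw [Set.encard_le_one_iff]
  rintro _ _ ⟨⟨s, rfl⟩, hs⟩ ⟨⟨t, rfl⟩, ht⟩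
  by_contra hne
  have hst : s - t ≠ 0 := fun h => hne (by rw [sub_eq_zero.1 h])
  rw [mem_lineThrough_iff hu'] at hs ht
  simp only [PiLp.add_apply, PiLp.smul_apply, smul_eq_mul] at hs ht
  have h1 : u 1 * u' 0 - u 0 * u' 1 = 0 := by
    apply mul_left_cancel₀ hst
    linear_combination hs - ht
  apply h
  rintro _ ⟨w, rfl⟩
  rw [mem_lineThrough_iff hu']
  simp only [PiLp.add_apply, PiLp.smul_apply, smul_eq_mul]
  linear_combination hs + (w - s) * h1

theorem encard_line_inter_sphere_le {c u : Plane} (hu : u ≠ 0) (c' : Plane) {r : ℝ} (hr : 0 ≤ r) :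
    (lineThrough c u ∩ Metric.sphere c' r).encard ≤ 2 := by
  have h0 := (plane_ne_zero_iff.1 hu).ne'
  refine encard_le_two ?_
  rintro _ ⟨⟨t₁, rfl⟩, h₁⟩ _ ⟨⟨t₂, rfl⟩, h₂⟩ _ ⟨⟨t₃, rfl⟩, h₃⟩ h12 h13 h23
  rw [mem_sphere_plane hr] at h₁ h₂ h₃
  simp only [PiLp.add_apply, PiLp.smul_apply, smul_eq_mul] at h₁ h₂ h₃
  have n12 : t₁ - t₂ ≠ 0 := fun h => h12 (by rw [sub_eq_zero.1 h])
  have n13 : t₁ - t₃ ≠ 0 := fun h => h13 (by rw [sub_eq_zero.1 h])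
  have n23 : t₂ - t₃ ≠ 0 := fun h => h23 (by rw [sub_eq_zero.1 h])
  have e12 : (u 0 ^ 2 + u 1 ^ 2) * (t₁ + t₂) + 2 * ((c 0 - c' 0) * u 0 + (c 1 - c' 1) * u 1) = 0 := by
    apply mul_left_cancel₀ n12
    linear_combination h₁ - h₂
  have e13 : (u 0 ^ 2 + u 1 ^ 2) * (t₁ + t₃) + 2 * ((c 0 - c' 0) * u 0 + (c 1 - c' 1) * u 1) = 0 := by
    apply mul_left_cancel₀ n13
    linear_combination h₁ - h₃
  exact mul_ne_zero h0 n23 (by linear_combination e12 - e13)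

theorem encard_sphere_inter_sphere_le {c c' : Plane} {r r' : ℝ}
    (h : Metric.sphere c r ≠ Metric.sphere c' r') :
    (Metric.sphere c r ∩ Metric.sphere c' r').encard ≤ 2 := by
  refine encard_le_two fun x hx y hy z hz hxy hxz hyz => ?_
  by_cases hc : c = c'
  · subst hc
    apply h
    rw [← Metric.mem_sphere.1 hx.1, ← Metric.mem_sphere.1 hx.2]
  · rcases EuclideanGeometry.eq_of_dist_eq_of_dist_eq_of_finrank_eq_two (by simp) hc hxy
      hx.1 hy.1 hz.1 hx.2 hy.2 hz.2 with h | h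
    · exact hxz h.symm
    · exact hyz h.symm

theorem numRegions_union_lineThrough_le {K : Set Plane} (hK : IsClosed K) (c u : Plane)
    (hu : u ≠ 0) (hfin : (lineThrough c u ∩ K).Finite) :
    numRegions (K ∪ lineThrough c u) ≤ numRegions K + (lineThrough c u ∩ K).encard + 1 := by
  have : Finite ↥(lineThrough c u ∩ K) := hfin.to_subtype
  have h := numRegions_union_line_le hK c u hu isOpen_univ Set.ordConnected_univ
    (by rw [← lineThrough_eq_image]; exact hK.union (isClosed_lineThrough hu))
    (fun x : ↥(lineThrough c u ∩ K) => {(x : Plane)}) (fun x => convex_singleton _)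
    (by rw [← lineThrough_eq_image, Set.iUnion_of_singleton_coe, ← Set.inter_assoc,
          Set.inter_self])
  rw [← lineThrough_eq_image] at h
  refine h.trans ?_
  rw [Nat.cast_add, ← add_assoc, Nat.cast_one]
  gcongr
  rw [← hfin.cast_ncard_eq]
  exact_mod_cast Set.ncard_le_card _

/-- A circle together with a line through its centre. -/
def phiFigure (c u : Plane) (r : ℝ) : Set Plane := Metric.sphere c r ∪ lineThrough c u

theorem sphere_inter_lineThrough_nonempty (c : Plane) {u : Plane} (hu : u ≠ 0) {r : ℝ}
    (hr : 0 < r) : (Metric.sphere c r ∩ lineThrough c u).Nonempty := by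
  have hn : 0 < ‖u‖ := norm_pos_iff.2 hu
  refine ⟨c + (r / ‖u‖) • u, ?_, _, rfl⟩
  rw [mem_sphere_iff_norm, add_sub_cancel_left, norm_smul, Real.norm_of_nonneg (by positivity),
    div_mul_cancel₀ _ hn.ne']

theorem encard_phiFigure_inter_le {c u c' u' : Plane} {r r' : ℝ} (hr : 0 < r) (hr' : 0 < r')
    (hu : u ≠ 0) (hu' : u' ≠ 0) (hfin : (phiFigure c u r ∩ phiFigure c' u' r').Finite) :
    (phiFigure c u r ∩ phiFigure c' u' r').encard ≤ 7 := by
  have h1 : (Metric.sphere c r ∩ Metric.sphere c' r').encard ≤ 2 := by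
    refine encard_sphere_inter_sphere_le fun h => infinite_sphere c hr (hfin.subset ?_)
    exact Set.subset_inter Set.subset_union_left (h.subset.trans Set.subset_union_left)
  have h2 : (lineThrough c u ∩ lineThrough c' u').encard ≤ 1 := by
    refine encard_line_inter_line_le hu' fun h => infinite_lineThrough c hu (hfin.subset ?_)
    exact Set.subset_inter Set.subset_union_right (h.trans Set.subset_union_right)
  have h3 := encard_line_inter_sphere_le (c := c) hu c' hr'.le
  have h4 := encard_line_inter_sphere_le (c := c') hu' c hr.le
  rw [Set.inter_comm] at h4
  have e : phiFigure c u r ∩ phiFigure c' u' r' =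
      (Metric.sphere c r ∩ Metric.sphere c' r') ∪ (Metric.sphere c r ∩ lineThrough c' u') ∪
      (lineThrough c u ∩ Metric.sphere c' r') ∪ (lineThrough c u ∩ lineThrough c' u') := by
    ext x
    simp only [phiFigure, Set.mem_inter_iff, Set.mem_union]
    tauto
  rw [e]
  calc _ ≤ (2 + 2 + 2 + 1 : ℕ∞) :=
        (Set.encard_union_le _ _).trans (add_le_add ((Set.encard_union_le _ _).trans
          (add_le_add ((Set.encard_union_le _ _).trans (add_le_add h1 h4)) h3)) h2)
    _ = 7 := by norm_num

theorem isClosed_phiFigure {c u : Plane} {r : ℝ} (hu : u ≠ 0) : IsClosed (phiFigure c u r) :=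
  Metric.isClosed_sphere.union (isClosed_lineThrough hu)

/-- A line or circle contained in an old one adds nothing. Otherwise the line meets each old figure
in at most 3 points and the circle in at most 4. The line goes first: its points on the circle make
the circle bound applicable, and they account for the `+ 2`. -/
theorem numRegions_union_constrainedPhi_le (n : ℕ) (S : Fin n → Set Plane)
    (hS : ∀ i, IsConstrainedPhi (S i)) (T : Set Plane) (hT : IsConstrainedPhi T) :
    numRegions ((⋃ i, S i) ∪ T) ≤ numRegions (⋃ i, S i) + (7 * n + 3 : ℕ) := by
  obtain ⟨c, u, r, hr, hu, rfl⟩ := hT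
  change ∀ i, ∃ c u r, 0 < r ∧ u ≠ 0 ∧ S i = phiFigure c u r at hS
  choose c' u' r' hr' hu' hS' using hS
  have hK : IsClosed (⋃ i, S i) :=
    isClosed_iUnion_of_finite fun i => by rw [hS']; exact isClosed_phiFigure (hu' i)
  set K := ⋃ i, S i with hKdef
  change numRegions (K ∪ phiFigure c u r) ≤ _
  set L := lineThrough c u with hL
  set C := Metric.sphere c r with hC
  have hKL : IsClosed (K ∪ L) := hK.union (isClosed_lineThrough hu)
  have s1 : numRegions (K ∪ L) ≤ numRegions K + (3 * n + 1 : ℕ) := by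
    by_cases h : ∃ i, L ⊆ lineThrough (c' i) (u' i)
    · obtain ⟨i, hi⟩ := h
      have hLK : L ⊆ K := hi.trans (Set.subset_union_right.trans
        ((hS' i).symm.subset.trans (Set.subset_iUnion S i)))
      rw [Set.union_eq_left.2 hLK]
      exact le_self_add
    · push Not at h
      have hle : (L ∩ K).encard ≤ (n * 3 : ℕ) := by
        refine encard_inter_iUnion_le L S 3 fun i => ?_
        rw [hS', phiFigure, Set.inter_union_distrib_left]
        refine (Set.encard_union_le _ _).trans ((add_le_add
          (encard_line_inter_sphere_le hu _ (hr' i).le)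
          (encard_line_inter_line_le (hu' i) (h i))).trans ?_)
        norm_num
      refine (numRegions_union_lineThrough_le hK c u hu
        (Set.finite_of_encard_le_coe hle)).trans ?_
      rw [add_assoc, Nat.cast_add, mul_comm 3 n]
      gcongr
      simp
  have s2 : numRegions (K ∪ L ∪ C) ≤ numRegions (K ∪ L) + (4 * n + 2 : ℕ) := by
    by_cases h : ∃ i, C = Metric.sphere (c' i) (r' i)
    · obtain ⟨i, hi⟩ := h
      have hCK : C ⊆ K ∪ L := hi.subset.trans (Set.subset_union_left.trans
        ((hS' i).symm.subset.trans ((Set.subset_iUnion S i).trans Set.subset_union_left)))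
      rw [Set.union_eq_left.2 hCK]
      exact le_self_add
    · push Not at h
      have hle : (C ∩ (K ∪ L)).encard ≤ (4 * n + 2 : ℕ) := by
        rw [Set.inter_union_distrib_left, mul_comm, Nat.cast_add]
        refine (Set.encard_union_le _ _).trans (add_le_add ?_ ?_)
        · refine encard_inter_iUnion_le C S 4 fun i => ?_
          rw [hS', phiFigure, Set.inter_union_distrib_left]
          refine (Set.encard_union_le _ _).trans ((add_le_add
            (encard_sphere_inter_sphere_le (h i)) ?_).trans
            (show (2 : ℕ∞) + 2 ≤ (4 : ℕ) by norm_num))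
          rw [Set.inter_comm]
          exact encard_line_inter_sphere_le (hu' i) _ hr.le
        · rw [Set.inter_comm]
          exact encard_line_inter_sphere_le hu _ hr.le
      have hfin := Set.finite_of_encard_le_coe hle
      refine (numRegions_union_circle_le hKL c hr hfin
        ((sphere_inter_lineThrough_nonempty c hu hr).mono
          (Set.inter_subset_inter_right _ Set.subset_union_right))).trans ?_
      rw [hfin.cast_ncard_eq]
      gcongr
  have e : K ∪ phiFigure c u r = K ∪ L ∪ C := by
    rw [phiFigure, Set.union_comm C L, Set.union_assoc]
  rw [e]
  refine s2.trans ((add_le_add_left s1 _).trans (le_of_eq ?_))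
  rw [add_assoc, ← Nat.cast_add]
  congr 2
  ring

/-! ### Separated points on a curve. -/

/-- One point is chosen in each gap of `S`. The right end varies in the induction, since below the
largest element `M` the interval becomes `(a, M)`. -/
theorem Finset.exists_interlacing (S : Finset ℝ) (a b : ℝ) (hab : a < b)
    (hS : ∀ x ∈ S, x ∈ Set.Ioo a b) :
    ∃ T : Finset ℝ, T.card = S.card + 1 ∧ (∀ t ∈ T, t ∈ Set.Ioo a b ∧ t ∉ S) ∧
      ∀ s ∈ T, ∀ t ∈ T, s < t → ∃ x ∈ S, s < x ∧ x < t := by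
  induction S using Finset.induction_on_max generalizing b with
  | empty =>
    refine ⟨{(a + b) / 2}, by simp, ?_, ?_⟩
    · simp only [Finset.mem_singleton, Finset.notMem_empty, not_false_eq_true, and_true, forall_eq]
      constructor <;> linarith
    · simp only [Finset.mem_singleton]
      rintro s rfl t rfl h
      exact absurd h (lt_irrefl _)
  | insert M S hM ih =>
    have hMab := hS M (Finset.mem_insert_self _ _)
    have hMS : M ∉ S := fun h => lt_irrefl _ (hM M h)
    obtain ⟨T, hT, hTab, hTS⟩ := ih M hMab.1 fun x hx =>
      ⟨(hS x (Finset.mem_insert_of_mem hx)).1, hM x hx⟩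
    have hnew : (M + b) / 2 ∉ T := fun h => by
      have := (hTab _ h).1.2
      linarith [hMab.2]
    refine ⟨insert ((M + b) / 2) T, ?_, ?_, ?_⟩
    · rw [Finset.card_insert_of_notMem hnew, Finset.card_insert_of_notMem hMS, hT]
    · intro t ht
      rcases Finset.mem_insert.1 ht with rfl | ht
      · refine ⟨⟨by linarith [hMab.1, hMab.2], by linarith [hMab.2]⟩, fun h => ?_⟩
        rcases Finset.mem_insert.1 h with h | h
        · linarith [hMab.2]
        · linarith [hM _ h, hMab.2]
      · refine ⟨⟨(hTab t ht).1.1, (hTab t ht).1.2.trans hMab.2⟩, fun h => ?_⟩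
        rcases Finset.mem_insert.1 h with h | h
        · exact (hTab t ht).1.2.ne h
        · exact (hTab t ht).2 h
    · intro s hs t ht hst
      rcases Finset.mem_insert.1 ht with rfl | ht
      · rcases Finset.mem_insert.1 hs with rfl | hs
        · exact absurd hst (lt_irrefl _)
        · exact ⟨M, Finset.mem_insert_self _ _, (hTab s hs).1.2, by linarith [hMab.2]⟩
      · rcases Finset.mem_insert.1 hs with rfl | hs
        · linarith [(hTab t ht).1.2, hMab.2]
        · obtain ⟨x, hx, h⟩ := hTS s hs t ht hst
          exact ⟨x, Finset.mem_insert_of_mem hx, h⟩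

/-- A curve crossing `k` switches at distinct times contains `k + 1` separated points. -/
theorem exists_pairwiseSeparated {X : Type*} [TopologicalSpace X] {K : Set X} (γ : ℝ → X)
    {a b : ℝ} (hab : a < b) {ι : Type*} [Fintype ι] (p : ι → ℝ) (hp : Function.Injective p)
    (hpab : ∀ k, p k ∈ Set.Ioo a b) (P : ι → Set X) (hPK : ∀ k, frontier (P k) ⊆ K)
    (hP : ∀ k, ∀ t ∈ Set.Ioo a b, t ≠ p k → (γ t ∈ P k ↔ p k < t)) :
    ∃ T : Set X, T ⊆ γ '' {t ∈ Set.Ioo a b | ∀ k, t ≠ p k} ∧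
      T.encard = (Fintype.card ι + 1 : ℕ) ∧ PairwiseSeparated K T := by
  classical
  obtain ⟨T, hT, hTab, hTS⟩ := (Finset.univ.image p).exists_interlacing a b hab (by
    simpa using fun k => hpab k)
  have hTp : ∀ t ∈ T, ∀ k, t ≠ p k := fun t ht k h => (hTab t ht).2 (by simp [h])
  have hsep : ∀ s ∈ T, ∀ t ∈ T, s < t → ∃ k, γ s ∉ P k ∧ γ t ∈ P k := by
    intro s hs t ht hst
    obtain ⟨x, hx, hsx, hxt⟩ := hTS s hs t ht hst
    obtain ⟨k, -, rfl⟩ := Finset.mem_image.1 hx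
    exact ⟨k, fun h => hsx.not_gt ((hP k s (hTab s hs).1 hsx.ne).1 h),
      (hP k t (hTab t ht).1 hxt.ne').2 hxt⟩
  refine ⟨γ '' T, ?_, ?_, ?_⟩
  · exact Set.image_mono fun t ht => ⟨(hTab t ht).1, hTp t ht⟩
  · rw [Set.InjOn.encard_image, Set.encard_coe_eq_coe_finsetCard, hT,
      Finset.card_image_of_injective _ hp, Finset.card_univ]
    intro s hs t ht hst
    rcases lt_trichotomy s t with h | h | h
    · obtain ⟨k, h1, h2⟩ := hsep s hs t ht h
      exact absurd (hst ▸ h2) h1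
    · exact h
    · obtain ⟨k, h1, h2⟩ := hsep t ht s hs h
      exact absurd (hst.symm ▸ h2) h1
  · rintro _ ⟨s, hs, rfl⟩ _ ⟨t, ht, rfl⟩ hne
    rcases lt_trichotomy s t with h | h | h
    · obtain ⟨k, h1, h2⟩ := hsep s hs t ht h
      exact ⟨P k, hPK k, by tauto⟩
    · exact absurd (congrArg γ h) hne
    · obtain ⟨k, h1, h2⟩ := hsep t ht s hs h
      exact ⟨P k, hPK k, by tauto⟩

theorem PairwiseSeparated.mono {X : Type*} [TopologicalSpace X] {K K' T : Set X} (hK : K ⊆ K')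
    (h : PairwiseSeparated K T) : PairwiseSeparated K' T := fun x hx y hy hxy => by
  obtain ⟨P, hP, hP'⟩ := h x hx y hy hxy
  exact ⟨P, hP.trans hK, hP'⟩

/-- Used for the two halves of a new circle, which its own diameter keeps apart. -/
theorem PairwiseSeparated.union {X : Type*} [TopologicalSpace X] {K T T' P : Set X}
    (hT : PairwiseSeparated K T) (hT' : PairwiseSeparated K T') (hP : frontier P ⊆ K)
    (hTP : T ⊆ P) (hTP' : Disjoint T' P) : PairwiseSeparated K (T ∪ T') := by
  have hout : ∀ x ∈ T', x ∉ P := fun _ hx => Set.disjoint_left.1 hTP' hx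
  rintro x (hx | hx) y (hy | hy) hxy
  · exact hT x hx y hy hxy
  · exact ⟨P, hP, by simp [hTP hx, hout y hy]⟩
  · exact ⟨P, hP, by simp [hTP hy, hout x hx]⟩
  · exact hT' x hx y hy hxy

theorem mem_closure_of_forall_smul {P : Set Plane} {x w : Plane}
    (h : ∀ ε : ℝ, 0 < ε → ε < 1 → x + ε • w ∈ P) : x ∈ closure P := by
  have hc : Filter.Tendsto (fun ε : ℝ => x + ε • w) (nhdsWithin 0 (Set.Ioi 0)) (nhds x) := by
    have : Continuous fun ε : ℝ => x + ε • w := by fun_prop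
    have h0 := this.tendsto 0
    simp only [zero_smul, add_zero] at h0
    exact h0.mono_left nhdsWithin_le_nhds
  refine mem_closure_of_tendsto hc ?_
  filter_upwards [Ioo_mem_nhdsGT (show (0 : ℝ) < 1 from one_pos)] with ε hε
  exact h ε hε.1 hε.2

theorem numRegions_add_encard_le {K A P Q T : Set Plane} (hK : IsClosed K)
    (hP : IsOpen P) (hQ : IsOpen Q) (hPQ : Disjoint P Q) (hcover : (K ∪ A)ᶜ ⊆ P ∪ Q)
    (hA : A \ K ⊆ closure P ∩ closure Q) (hTA : T ⊆ A \ K) (hT : PairwiseSeparated K T) :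
    numRegions K + T.encard ≤ numRegions (K ∪ A) := by
  rw [numRegions_eq_encard, numRegions_eq_encard]
  exact encard_components_add_le hK hP hQ hPQ hcover hA hTA hT

theorem frontier_pos_subset {f : Plane → ℝ} (hf : Continuous f) :
    frontier {x | 0 < f x} ⊆ {x | f x = 0} := fun _ hx =>
  (frontier_lt_subset_eq continuous_const hf hx).symm

/-! ### An extremal family of H figures. -/

/-- The set cut out by the lines `y = s x ± h` and the perpendicular crossbar `x + s y = e`. -/
def hSet (s e h : ℝ) : Set Plane :=
  {x | x 1 - s * x 0 - h = 0} ∪ {x | x 1 - s * x 0 + h = 0} ∪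
    {x | x 0 + s * x 1 - e = 0 ∧ 0 < x 1 - s * x 0 + h ∧ x 1 - s * x 0 - h < 0}

theorem isConstrainedH_hSet (s e : ℝ) {h : ℝ} (hh : 0 < h) : IsConstrainedH (hSet s e h) := by
  have hs : 0 < 1 + s ^ 2 := by positivity
  -- `p` and `q` are the points where `x + s y = e` meets the lines `y = s x - h` and `y = s x + h`.
  set p : Plane := !₂[(e + s * h) / (1 + s ^ 2), (s * e - h) / (1 + s ^ 2)] with hp
  set q : Plane := !₂[(e - s * h) / (1 + s ^ 2), (s * e + h) / (1 + s ^ 2)] with hq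
  have p0 : p 0 = (e + s * h) / (1 + s ^ 2) := rfl
  have p1 : p 1 = (s * e - h) / (1 + s ^ 2) := rfl
  have q0 : q 0 = (e - s * h) / (1 + s ^ 2) := rfl
  have q1 : q 1 = (s * e + h) / (1 + s ^ 2) := rfl
  have d0 : q 0 - p 0 = -s * (2 * h / (1 + s ^ 2)) := by rw [p0, q0]; field_simp; ring
  have d1 : q 1 - p 1 = 2 * h / (1 + s ^ 2) := by rw [p1, q1]; field_simp; ring
  have hlam : 0 < 2 * h / (1 + s ^ 2) := by positivity
  have hpU : p 1 - s * p 0 = -h := by rw [p0, p1]; field_simp; ring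
  have hqU : q 1 - s * q 0 = h := by rw [q0, q1]; field_simp; ring
  have hpV : p 0 + s * p 1 = e := by rw [p0, p1]; field_simp; ring
  refine ⟨p, q, fun hpq => ?_, ?_⟩
  · rw [hpq, sub_self] at d1
    exact hlam.ne d1
  have hline : ∀ r x : Plane, x ∈ perpLine r (q - p) ↔ x 1 - s * x 0 - (r 1 - s * r 0) = 0 := by
    intro r x
    simp only [perpLine, Set.mem_ofPred_eq, inner_plane, PiLp.sub_apply, d0, d1]
    constructor
    · intro hx
      apply mul_left_cancel₀ hlam.ne'
      linear_combination hx
    · intro hx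
      linear_combination 2 * h / (1 + s ^ 2) * hx
  rw [hFigure_eq_union]
  ext x
  simp only [hSet, Set.mem_union, Set.mem_ofPred_eq, hline, hpU, hqU, sub_neg_eq_add]
  rw [or_comm (a := x 1 - s * x 0 - h = 0)]
  refine or_congr Iff.rfl ?_
  rw [openSegment_eq_image_smul]
  constructor
  · rintro ⟨hV, hU, hT⟩
    refine ⟨(x 1 - s * x 0 + h) / (2 * h), ⟨by positivity, ?_⟩, ?_⟩
    · rw [div_lt_one (by positivity)]; linarith
    · apply plane_ext
      · simp only [PiLp.add_apply, PiLp.smul_apply, PiLp.sub_apply, smul_eq_mul, d0]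
        rw [p0]
        field_simp
        linear_combination (-1 : ℝ) * hV
      · simp only [PiLp.add_apply, PiLp.smul_apply, PiLp.sub_apply, smul_eq_mul, d1]
        rw [p1]
        field_simp
        linear_combination (-s) * hV
  · rintro ⟨t, ht, rfl⟩
    have e1 : p 1 + t * (2 * h / (1 + s ^ 2)) - s * (p 0 + t * (-s * (2 * h / (1 + s ^ 2)))) =
        -h + 2 * h * t := by
      rw [← hpU]; field_simp; ring
    simp only [PiLp.add_apply, PiLp.smul_apply, PiLp.sub_apply, smul_eq_mul, d0, d1, e1]
    refine ⟨by linear_combination hpV, ?_, ?_⟩ <;> nlinarith [ht.1, ht.2]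

theorem isClosed_hSet (s e : ℝ) {h : ℝ} (hh : 0 < h) : IsClosed (hSet s e h) :=
  isClosed_of_isConstrainedH (isConstrainedH_hSet s e hh)

/-- The points above, or between the lines and to the right of the crossbar. -/
def hRight (s e h : ℝ) : Set Plane :=
  {x | 0 < x 1 - s * x 0 - h} ∪ ({x | 0 < x 1 - s * x 0 + h} ∩ {x | 0 < x 0 + s * x 1 - e})

theorem frontier_upper_subset (s e h : ℝ) :
    frontier {x : Plane | 0 < x 1 - s * x 0 - h} ⊆ hSet s e h := fun _ hx =>
  Or.inl (Or.inl (frontier_pos_subset (by fun_prop) hx))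

theorem frontier_lower_subset (s e h : ℝ) :
    frontier {x : Plane | 0 < x 1 - s * x 0 + h} ⊆ hSet s e h := fun _ hx =>
  Or.inl (Or.inr (frontier_pos_subset (by fun_prop) hx))

/-- A half plane beside the crossbar has a whole line as frontier, which is not in the figure.
Restricting to the strip and gluing on the half plane above leaves only the crossbar and rays of the
two lines. -/
theorem frontier_hRight_subset (s e h : ℝ) : frontier (hRight s e h) ⊆ hSet s e h := by
  intro x hx
  rcases frontier_union_subset _ _ hx with hx | ⟨hx1, hx2⟩
  · exact frontier_upper_subset s e h hx.1
  · rcases frontier_inter_subset _ _ hx2 with hx2 | ⟨hx2, hx3⟩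
    · exact frontier_lower_subset s e h hx2.1
    · have h1 : x 1 - s * x 0 - h ≤ 0 := by
        have hc : IsClosed {x : Plane | x 1 - s * x 0 - h ≤ 0} :=
          isClosed_le (by fun_prop) continuous_const
        exact closure_minimal (s := {x : Plane | 0 < x 1 - s * x 0 - h}ᶜ)
          (fun y hy => not_lt.1 (show ¬ 0 < y 1 - s * y 0 - h from hy)) hc hx1
      have h2 : 0 ≤ x 1 - s * x 0 + h := by
        have hc : IsClosed {x : Plane | 0 ≤ x 1 - s * x 0 + h} :=
          isClosed_le continuous_const (by fun_prop)
        exact closure_minimal (s := {x : Plane | 0 < x 1 - s * x 0 + h})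
          (fun y hy => le_of_lt (show 0 < y 1 - s * y 0 + h from hy)) hc hx2
      have h3 : x 0 + s * x 1 - e = 0 := frontier_pos_subset (by fun_prop) hx3
      rcases h1.lt_or_eq with h1 | h1
      · rcases h2.lt_or_eq with h2 | h2
        · exact Or.inr ⟨h3, h2, h1⟩
        · exact Or.inl (Or.inr h2.symm)
      · exact Or.inl (Or.inl h1)

/-- Adding a line that meets all two lines and crossbars of `n` figures at distinct points. -/
theorem numRegions_union_crossing_line {n : ℕ} (s e h : Fin n → ℝ) {K : Set Plane}
    (hK : IsClosed K) (hSK : ∀ i, hSet (s i) (e i) (h i) ⊆ K) (m k : ℝ)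
    (hA : ∀ x ∈ K, x 1 - m * x 0 - k = 0 → ∃ i, x ∈ hSet (s i) (e i) (h i))
    (t : Fin n × Fin 3 → ℝ) (ht : Function.Injective t) (α β δ : Fin n → ℝ)
    (hα : ∀ i, 0 < α i) (hβ : ∀ i, 0 < β i) (hδ : ∀ i, 0 < δ i)
    (h01 : ∀ i, t (i, 0) < t (i, 1)) (h12 : ∀ i, t (i, 1) < t (i, 2))
    (hlower : ∀ i x, m * x + k - s i * x + h i = α i * (x - t (i, 0)))
    (hbar : ∀ i x, x + s i * (m * x + k) - e i = β i * (x - t (i, 1)))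
    (hupper : ∀ i x, m * x + k - s i * x - h i = δ i * (x - t (i, 2))) :
    numRegions K + (3 * n + 1 : ℕ) ≤ numRegions (K ∪ {x | x 1 - m * x 0 - k = 0}) := by
  obtain ⟨M, hM⟩ := (Set.finite_range t).bddAbove
  obtain ⟨M', hM'⟩ := (Set.finite_range t).bddBelow
  have hpos : ∀ {a y : ℝ}, 0 < a → (0 < a * y ↔ 0 < y) := fun ha => mul_pos_iff_of_pos_left ha
  let γ : ℝ → Plane := fun x => !₂[x, m * x + k]
  have γ0 : ∀ x, γ x 0 = x := fun _ => rfl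
  have γ1 : ∀ x, γ x 1 = m * x + k := fun _ => rfl
  -- Along the new line each set is entered exactly once, at its time `t z`. For the crossbar this
  -- uses `h01` and `h12`: the crossing happens between those of the two lines.
  let P : Fin n × Fin 3 → Set Plane := fun z =>
    ![{x | 0 < x 1 - s z.1 * x 0 + h z.1}, hRight (s z.1) (e z.1) (h z.1),
      {x | 0 < x 1 - s z.1 * x 0 - h z.1}] z.2
  have hPK : ∀ z, frontier (P z) ⊆ K := by
    rintro ⟨i, j⟩
    fin_cases j
    · exact (frontier_lower_subset _ (e i) _).trans (hSK i)
    · exact (frontier_hRight_subset _ _ _).trans (hSK i)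
    · exact (frontier_upper_subset _ (e i) _).trans (hSK i)
  have hPt : ∀ z, ∀ x ∈ Set.Ioo (min M' M - 1) (max M' M + 1), x ≠ t z →
      (γ x ∈ P z ↔ t z < x) := by
    rintro ⟨i, j⟩ x - hx
    fin_cases j
    · change 0 < γ x 1 - s i * γ x 0 + h i ↔ t (i, 0) < x
      rw [γ0, γ1, hlower, hpos (hα i), sub_pos]
    · change (0 < γ x 1 - s i * γ x 0 - h i ∨
        (0 < γ x 1 - s i * γ x 0 + h i ∧ 0 < γ x 0 + s i * γ x 1 - e i)) ↔ t (i, 1) < x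
      rw [γ0, γ1, hlower, hupper, hbar, hpos (hα i), hpos (hδ i), hpos (hβ i), sub_pos, sub_pos,
        sub_pos]
      exact ⟨fun h => h.elim (fun h => (h12 i).trans h) fun h => h.2,
        fun h => Or.inr ⟨(h01 i).trans h, h⟩⟩
    · change 0 < γ x 1 - s i * γ x 0 - h i ↔ t (i, 2) < x
      rw [γ0, γ1, hupper, hpos (hδ i), sub_pos]
  obtain ⟨T, hT, hTc, hTs⟩ := exists_pairwiseSeparated (K := K) γ
    (a := min M' M - 1) (b := max M' M + 1)
    (by linarith [min_le_left M' M, le_max_left M' M]) t ht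
    (fun z => ⟨by linarith [min_le_left M' M, hM' ⟨z, rfl⟩],
      by linarith [le_max_right M' M, hM ⟨z, rfl⟩]⟩) P hPK hPt
  simp only [Fintype.card_prod, Fintype.card_fin] at hTc
  rw [mul_comm 3 n, ← hTc]
  refine numRegions_add_encard_le hK (P := {x : Plane | 0 < x 1 - m * x 0 - k})
    (Q := {x : Plane | x 1 - m * x 0 - k < 0}) (isOpen_lt continuous_const (by fun_prop))
    (isOpen_lt (by fun_prop) continuous_const) ?_ ?_ ?_ ?_ hTs
  · exact Set.disjoint_left.2 fun x hx hx' =>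
      lt_asymm (show 0 < x 1 - m * x 0 - k from hx) hx'
  · intro x hx
    rcases lt_trichotomy (x 1 - m * x 0 - k) 0 with h | h | h
    · exact Or.inr h
    · exact absurd (Or.inr h) hx
    · exact Or.inl h
  · rintro x ⟨hx, -⟩
    have hx : x 1 - m * x 0 - k = 0 := hx
    refine ⟨mem_closure_of_forall_smul (w := !₂[0, 1]) fun ε hε _ => ?_,
      mem_closure_of_forall_smul (w := !₂[0, -1]) fun ε hε _ => ?_⟩
    · simp; linarith
    · simp; linarith
  · rintro _ hx
    obtain ⟨y, ⟨-, hy⟩, rfl⟩ := hT hx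
    have hγ : γ y 1 - m * γ y 0 - k = 0 := by rw [γ0, γ1]; ring
    refine ⟨hγ, fun hyK => ?_⟩
    obtain ⟨i, hi⟩ := hA _ hyK hγ
    have hne : ∀ (j : Fin 3) (a : ℝ), 0 < a → a * (y - t (i, j)) ≠ 0 := fun j a ha =>
      mul_ne_zero ha.ne' (sub_ne_zero.2 (hy (i, j)))
    rcases hi with (hi | hi) | hi
    · exact hne 2 _ (hδ i) (by rw [← hupper]; exact hi)
    · exact hne 0 _ (hα i) (by rw [← hlower]; exact hi)
    · exact hne 1 _ (hβ i) (by rw [← hbar]; exact hi.1)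

/-- Adding a crossbar between two lines that meets `n` other crossbars at distinct points. -/
theorem numRegions_union_crossing_bar {n : ℕ} (s e h : Fin n → ℝ) {K : Set Plane}
    (hK : IsClosed K) (hSK : ∀ i, hSet (s i) (e i) (h i) ⊆ K) (a c w : ℝ)
    (htop : {x : Plane | x 1 - a * x 0 - w = 0} ⊆ K)
    (hbot : {x : Plane | x 1 - a * x 0 + w = 0} ⊆ K)
    (hA : ∀ x ∈ K, x 0 + a * x 1 - c = 0 → 0 < x 1 - a * x 0 + w → x 1 - a * x 0 - w < 0 →
      ∃ i, x ∈ hSet (s i) (e i) (h i))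
    (b : ℝ) (hb : 0 < b) (t : Fin n → ℝ) (ht : Function.Injective t)
    (htb : ∀ i, t i ∈ Set.Ioo 0 b) (β : Fin n → ℝ) (hβ : ∀ i, 0 < β i)
    (hin : ∀ y ∈ Set.Ioo 0 b, 0 < y - a * (c - a * y) + w ∧ y - a * (c - a * y) - w < 0)
    (hin' : ∀ i, ∀ y ∈ Set.Ioo 0 b,
      0 < y - s i * (c - a * y) + h i ∧ y - s i * (c - a * y) - h i < 0)
    (hbar : ∀ i y, c - a * y + s i * y - e i = β i * (t i - y)) :
    numRegions K + (n + 1 : ℕ) ≤ numRegions (K ∪ {x : Plane | x 0 + a * x 1 - c = 0 ∧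
      0 < x 1 - a * x 0 + w ∧ x 1 - a * x 0 - w < 0}) := by
  let γ : ℝ → Plane := fun y => !₂[c - a * y, y]
  have γ0 : ∀ y, γ y 0 = c - a * y := fun _ => rfl
  have γ1 : ∀ y, γ y 1 = y := fun _ => rfl
  -- As `y` grows the new crossbar passes from the right of an old crossbar to its left, whence the
  -- complement of `hRight`.
  have hPt : ∀ i, ∀ y ∈ Set.Ioo 0 b, y ≠ t i → (γ y ∈ (hRight (s i) (e i) (h i))ᶜ ↔ t i < y) := by
    intro i y hy hne
    have hi' := hin' i y hy
    change ¬ (0 < γ y 1 - s i * γ y 0 - h i ∨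
        (0 < γ y 1 - s i * γ y 0 + h i ∧ 0 < γ y 0 + s i * γ y 1 - e i)) ↔ t i < y
    rw [γ0, γ1, hbar, mul_pos_iff_of_pos_left (hβ i)]
    constructor
    · intro hc
      by_contra hlt
      exact hc (Or.inr ⟨hi'.1, sub_pos.2 (lt_of_le_of_ne (not_lt.1 hlt) hne)⟩)
    · rintro hlt (h1 | ⟨-, h2⟩) <;> linarith [hi'.2]
  obtain ⟨T, hT, hTc, hTs⟩ := exists_pairwiseSeparated (K := K) γ hb t ht htb
    (fun i => (hRight (s i) (e i) (h i))ᶜ)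
    (fun i => by rw [frontier_compl]; exact (frontier_hRight_subset _ _ _).trans (hSK i)) hPt
  rw [Fintype.card_fin] at hTc
  rw [← hTc]
  have oT : ∀ v : ℝ, IsOpen {x : Plane | 0 < x 1 - a * x 0 + v} := fun v =>
    isOpen_lt continuous_const (by fun_prop)
  have oU : ∀ v : ℝ, IsOpen {x : Plane | x 1 - a * x 0 + v < 0} := fun v =>
    isOpen_lt (by fun_prop) continuous_const
  have oV : IsOpen {x : Plane | 0 < x 0 + a * x 1 - c} :=
    isOpen_lt continuous_const (by fun_prop)
  have oW : IsOpen {x : Plane | x 0 + a * x 1 - c < 0} :=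
    isOpen_lt (by fun_prop) continuous_const
  have hw : 0 < w := by
    have := hin (b / 2) ⟨by linarith, by linarith⟩
    linarith
  -- Since the top and bottom lines already lie in `K`, the half plane above may be joined to the
  -- right of the strip and the half plane below to its left; the crossbar separates the two.
  refine numRegions_add_encard_le hK
    (P := {x : Plane | 0 < x 1 - a * x 0 + -w} ∪
      ({x : Plane | 0 < x 1 - a * x 0 + w} ∩ {x : Plane | 0 < x 0 + a * x 1 - c}))
    (Q := {x : Plane | x 1 - a * x 0 + w < 0} ∪
      ({x : Plane | x 1 - a * x 0 + -w < 0} ∩ {x : Plane | x 0 + a * x 1 - c < 0}))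
    ((oT _).union ((oT _).inter oV)) ((oU _).union ((oU _).inter oW)) ?_ ?_ ?_ ?_ hTs
  · refine Set.disjoint_left.2 fun x hx hx' => ?_
    simp only [Set.mem_union, Set.mem_inter_iff, Set.mem_ofPred_eq] at hx hx'
    rcases hx with hx | ⟨hx, hx2⟩ <;> rcases hx' with hx' | ⟨hx', hx2'⟩ <;> linarith
  · intro x hx
    simp only [Set.mem_union, Set.mem_inter_iff, Set.mem_ofPred_eq]
    have h1 : x 1 - a * x 0 - w ≠ 0 := fun h => hx (Or.inl (htop h))
    have h2 : x 1 - a * x 0 + w ≠ 0 := fun h => hx (Or.inl (hbot h))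
    rcases lt_or_gt_of_ne h1 with h1 | h1
    · rcases lt_or_gt_of_ne h2 with h2 | h2
      · exact Or.inr (Or.inl h2)
      · rcases lt_trichotomy (x 0 + a * x 1 - c) 0 with h | h | h
        · exact Or.inr (Or.inr ⟨by linarith, h⟩)
        · exact absurd (Or.inr ⟨h, h2, h1⟩) hx
        · exact Or.inl (Or.inr ⟨h2, h⟩)
    · exact Or.inl (Or.inl (by linarith))
  · rintro x ⟨⟨hV, hU, hT⟩, -⟩
    refine ⟨mem_closure_of_forall_smul (w := !₂[1, a]) fun ε hε _ => Or.inr ⟨?_, ?_⟩,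
      mem_closure_of_forall_smul (w := !₂[-1, -a]) fun ε hε _ => Or.inr ⟨?_, ?_⟩⟩
    · simp; linarith
    · simp; nlinarith [mul_nonneg hε.le (sq_nonneg a)]
    · simp; linarith
    · simp; nlinarith [mul_nonneg hε.le (sq_nonneg a)]
  · rintro _ hx
    obtain ⟨y, ⟨hyb, hy⟩, rfl⟩ := hT hx
    have hV : γ y 0 + a * γ y 1 - c = 0 := by rw [γ0, γ1]; ring
    have hUT := hin y hyb
    rw [← γ0, ← γ1 y, γ0 (γ y 1), γ1 y, ← γ0] at hUT
    have hU : 0 < γ y 1 - a * γ y 0 + w := by rw [γ1]; exact hUT.1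
    have hT' : γ y 1 - a * γ y 0 - w < 0 := by rw [γ1]; exact hUT.2
    refine ⟨⟨hV, hU, hT'⟩, fun hyK => ?_⟩
    obtain ⟨i, hi⟩ := hA _ hyK hV hU hT'
    have hi' := hin' i y hyb
    rw [← γ0] at hi'
    rcases hi with (hi | hi) | hi
    · exact hi'.2.ne hi
    · exact hi'.1.ne' hi
    · refine mul_ne_zero (hβ i).ne' (sub_ne_zero.2 (hy i).symm) ?_
      rw [← hbar]
      exact hi.1

/-- A strictly increasing sequence in `(0, 1/10)`. -/
noncomputable def tilt (n : ℕ) : ℝ := 1 / 10 - 1 / (n + 11)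

theorem tilt_pos (n : ℕ) : 0 < tilt n := by
  rw [tilt, sub_pos]
  exact one_div_lt_one_div_of_lt (by norm_num) (by linarith [(Nat.cast_nonneg n : (0 : ℝ) ≤ n)])

theorem tilt_lt (n : ℕ) : tilt n < 1 / 10 := by
  have : (0 : ℝ) < 1 / (n + 11) := by positivity
  rw [tilt]; linarith

theorem tilt_strictMono : StrictMono tilt := by
  intro m n h
  have h' : (m : ℝ) < n := by exact_mod_cast h
  have := one_div_lt_one_div_of_lt (show (0 : ℝ) < m + 11 by positivity)
    (show (m : ℝ) + 11 < n + 11 by linarith)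
  rw [tilt, tilt]; linarith

/-- A family of figures any two of which meet in seven points. -/
noncomputable def hFamily (n : ℕ) : Set Plane := hSet (tilt n) (tilt n ^ 2) (1 - tilt n ^ 2)

theorem hFamily_height_pos (n : ℕ) : 0 < 1 - tilt n ^ 2 := by
  nlinarith [tilt_pos n, tilt_lt n]

theorem isConstrainedH_hFamily (n : ℕ) : IsConstrainedH (hFamily n) :=
  isConstrainedH_hSet _ _ (hFamily_height_pos n)

theorem mul_sub_div_self {c : ℝ} (hc : c ≠ 0) (x y : ℝ) : c * (x - y / c) = c * x - y := by
  field_simp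

theorem injective_of_layers {n : ℕ} (t : Fin n × Fin 3 → ℝ) (c d : ℝ)
    (h0 : ∀ i, t (i, 0) < c) (h1 : ∀ i, c < t (i, 1) ∧ t (i, 1) < d) (h2 : ∀ i, d < t (i, 2))
    (hinj : ∀ i i' j, t (i, j) = t (i', j) → i = i') : Function.Injective t := by
  rintro ⟨i, j⟩ ⟨i', j'⟩ h
  have hjj : j = j' := by
    have := h0 i; have := h1 i; have := h2 i; have := h0 i'; have := h1 i'; have := h2 i'
    fin_cases j <;> fin_cases j' <;> first | rfl | (exfalso; simp at h; linarith)
  subst hjj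
  rw [hinj i i' j h]

/-- The lines `y = a x + 1 - a²`, `y = a x - 1 + a²` and `x = a² - a y` are tangent to the parabolas
`y = 1 + x² / 4`, `y = -1 - x² / 4` and `x = -y² / 4`. Like pieces with parameters `a`, `b` thus
meet at coordinate `± (a + b)`, which determines `b`. The three pieces gain `3 n + 1`, `3 n + 1` and
`n + 1` regions. -/
theorem numRegions_add_le_union_hFamily (n : ℕ) :
    numRegions (⋃ i : Fin n, hFamily i) + (7 * n + 3 : ℕ) ≤
      numRegions ((⋃ i : Fin n, hFamily i) ∪ hFamily n) := by
  set K := ⋃ i : Fin n, hFamily i with hK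
  have hKc : IsClosed K :=
    isClosed_iUnion_of_finite fun i => isClosed_hSet _ _ (hFamily_height_pos i)
  set a := tilt n with ha
  have ha0 : 0 < a := tilt_pos n
  have ha1 : a < 1 / 10 := tilt_lt n
  have hw : 0 < 1 - a ^ 2 := hFamily_height_pos n
  let b : Fin n → ℝ := fun i => tilt i
  have hb0 : ∀ i, 0 < b i := fun i => tilt_pos i
  have hba : ∀ i, b i < a := fun i => tilt_strictMono i.2
  have hab : ∀ i, 0 < a - b i := fun i => sub_pos.2 (hba i)
  have hab1 : ∀ i, 0 < 1 + a * b i := fun i => by have := hb0 i; positivity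
  have hbinj : ∀ i i', b i - b i' = 0 → i = i' := fun i i' h =>
    Fin.ext (tilt_strictMono.injective (sub_eq_zero.1 h))
  have hsq : ∀ i, b i ^ 2 < 1 / 10 ∧ a ^ 2 < 1 / 10 ∧ 0 < b i ^ 2 ∧ 0 < a ^ 2 := fun i => by
    have := hb0 i; have := hba i
    refine ⟨by nlinarith, by nlinarith, by positivity, by positivity⟩
  have hbig : ∀ i, 1 < (2 - a ^ 2 - b i ^ 2) / (a - b i) := fun i => by
    have := hsq i; have := hb0 i
    rw [lt_div_iff₀ (hab i)]; linarith
  have hbigeq : ∀ i i', (2 - a ^ 2 - b i ^ 2) / (a - b i) = (2 - a ^ 2 - b i' ^ 2) / (a - b i') →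
      i = i' := fun i i' h => by
    have := hb0 i; have := hb0 i'; have := hba i; have := hba i'; have := hsq i
    rw [div_eq_div_iff (hab i).ne' (hab i').ne'] at h
    -- After cross-multiplication the difference of the two sides is `b i - b i'` times this factor;
    -- the other crossing times are treated the same way.
    have hpos : 0 < 2 - a ^ 2 - a * (b i + b i') + b i * b i' := by nlinarith
    refine hbinj i i' (mul_right_cancel₀ hpos.ne' ?_)
    linear_combination h
  set A₁ : Set Plane := {x | x 1 - a * x 0 - (1 - a ^ 2) = 0} with hA₁
  set A₂ : Set Plane := {x | x 1 - a * x 0 + (1 - a ^ 2) = 0} with hA₂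
  set A₃ : Set Plane := {x | x 0 + a * x 1 - a ^ 2 = 0 ∧ 0 < x 1 - a * x 0 + (1 - a ^ 2) ∧
    x 1 - a * x 0 - (1 - a ^ 2) < 0} with hA₃
  have hA₁c : IsClosed A₁ := isClosed_eq (by fun_prop) continuous_const
  have hA₂c : IsClosed A₂ := isClosed_eq (by fun_prop) continuous_const
  have hSK : ∀ i : Fin n, hSet (b i) (b i ^ 2) (1 - b i ^ 2) ⊆ K := fun i =>
    Set.subset_iUnion (fun i : Fin n => hFamily i) i
  have hKS : ∀ x ∈ K, ∃ i, x ∈ hSet (b i) (b i ^ 2) (1 - b i ^ 2) := fun x hx =>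
    Set.mem_iUnion.1 hx
  have s1 : numRegions K + (3 * n + 1 : ℕ) ≤ numRegions (K ∪ A₁) := by
    -- On the upper line the old lower lines, crossbars and upper lines are crossed at abscissas
    -- below `-1`, in `(-1, 0)` and above `0` respectively; on the lower line the division points
    -- are `0` and `1`.
    have h0 : ∀ i, -((2 - a ^ 2 - b i ^ 2) / (a - b i)) < -1 := fun i => neg_lt_neg (hbig i)
    have h1 : ∀ i, -1 < -(b i * (1 - a ^ 2 - b i)) / (1 + a * b i) ∧
        -(b i * (1 - a ^ 2 - b i)) / (1 + a * b i) < 0 := fun i => by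
      have := hb0 i; have := hba i; have := hsq i
      constructor
      · rw [lt_div_iff₀ (hab1 i)]; nlinarith
      · exact div_neg_of_neg_of_pos (neg_neg_of_pos (mul_pos (hb0 i) (by linarith))) (hab1 i)
    have h2 : ∀ i, 0 < a + b i := fun i => add_pos ha0 (hb0 i)
    refine numRegions_union_crossing_line b (fun i => b i ^ 2) (fun i => 1 - b i ^ 2) hKc hSK
      a (1 - a ^ 2) (fun x hx _ => hKS x hx)
      (fun z => ![-((2 - a ^ 2 - b z.1 ^ 2) / (a - b z.1)),
        -(b z.1 * (1 - a ^ 2 - b z.1)) / (1 + a * b z.1), a + b z.1] z.2)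
      (injective_of_layers _ (-1) 0 h0 h1 h2 ?_) (fun i => a - b i) (fun i => 1 + a * b i)
      (fun i => a - b i) hab hab1 hab (fun i => (h0 i).trans (h1 i).1)
      (fun i => (h1 i).2.trans (h2 i)) ?_ ?_ ?_
    · intro i i' j h
      fin_cases j
      · exact hbigeq i i' (neg_injective h)
      · have := hb0 i; have := hb0 i'; have := hba i; have := hba i'; have := hsq i
        replace h : -(b i * (1 - a ^ 2 - b i)) / (1 + a * b i) =
          -(b i' * (1 - a ^ 2 - b i')) / (1 + a * b i') := h
        rw [div_eq_div_iff (hab1 i).ne' (hab1 i').ne'] at h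
        have hpos : 0 < 1 - a ^ 2 - (b i + b i') - a * (b i * b i') := by
          have : a * (b i * b i') < 1 / 10 := by
            have : b i * b i' < 1 := by nlinarith
            nlinarith
          linarith
        refine hbinj i i' (mul_right_cancel₀ hpos.ne' ?_)
        linear_combination -h
      · exact hbinj i i' (by have : a + b i = a + b i' := h
                             linarith)
    · intro i x
      have := (hab i).ne'
      simp only [Matrix.cons_val_zero]
      field_simp
      ring
    · intro i x
      simp only [Matrix.cons_val_one, Matrix.cons_val_zero]
      rw [mul_sub_div_self (hab1 i).ne']
      ring
    · intro i x
      simp only [Matrix.cons_val]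
      ring
  have s2 : numRegions (K ∪ A₁) + (3 * n + 1 : ℕ) ≤ numRegions (K ∪ A₁ ∪ A₂) := by
    have h0 : ∀ i, -(a + b i) < 0 := fun i => neg_neg_of_pos (add_pos ha0 (hb0 i))
    have h1 : ∀ i, 0 < b i * (1 - a ^ 2 + b i) / (1 + a * b i) ∧
        b i * (1 - a ^ 2 + b i) / (1 + a * b i) < 1 := fun i => by
      have := hb0 i; have := hba i; have := hsq i
      constructor
      · exact div_pos (mul_pos (hb0 i) (by linarith)) (hab1 i)
      · rw [div_lt_one (hab1 i)]; nlinarith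
    have hset : A₂ = {x : Plane | x 1 - a * x 0 - -(1 - a ^ 2) = 0} := by
      simp only [hA₂, sub_neg_eq_add]
    rw [hset]
    refine numRegions_union_crossing_line b (fun i => b i ^ 2) (fun i => 1 - b i ^ 2)
      (hKc.union hA₁c) (fun i => (hSK i).trans Set.subset_union_left) a (-(1 - a ^ 2)) ?_
      (fun z => ![-(a + b z.1), b z.1 * (1 - a ^ 2 + b z.1) / (1 + a * b z.1),
        (2 - a ^ 2 - b z.1 ^ 2) / (a - b z.1)] z.2)
      (injective_of_layers _ 0 1 h0 h1 hbig ?_) (fun i => a - b i) (fun i => 1 + a * b i)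
      (fun i => a - b i) hab hab1 hab (fun i => (h0 i).trans (h1 i).1)
      (fun i => (h1 i).2.trans (hbig i)) ?_ ?_ ?_
    · rintro x (hx | hx) hx'
      · exact hKS x hx
      · have : x 1 - a * x 0 - (1 - a ^ 2) = 0 := hx
        linarith
    · intro i i' j h
      fin_cases j
      · exact hbinj i i' (by have : -(a + b i) = -(a + b i') := h
                             linarith)
      · have := hb0 i; have := hb0 i'; have := hba i; have := hba i'; have := hsq i
        replace h : b i * (1 - a ^ 2 + b i) / (1 + a * b i) =
          b i' * (1 - a ^ 2 + b i') / (1 + a * b i') := h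
        rw [div_eq_div_iff (hab1 i).ne' (hab1 i').ne'] at h
        have hpos : 0 < 1 - a ^ 2 + (b i + b i') + a * (b i * b i') := by
          have : 0 < a * (b i * b i') := by positivity
          linarith
        refine hbinj i i' (mul_right_cancel₀ hpos.ne' ?_)
        linear_combination h
      · exact hbigeq i i' h
    · intro i x
      simp only [Matrix.cons_val_zero]
      ring
    · intro i x
      simp only [Matrix.cons_val_one, Matrix.cons_val_zero]
      rw [mul_sub_div_self (hab1 i).ne']
      ring
    · intro i x
      have := (hab i).ne'
      simp only [Matrix.cons_val]
      field_simp
      ring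
  have s3 : numRegions (K ∪ A₁ ∪ A₂) + (n + 1 : ℕ) ≤ numRegions (K ∪ A₁ ∪ A₂ ∪ A₃) := by
    -- Only the ordinates in `(0, 1 / 4)` of the new crossbar are used. They contain every crossing
    -- `a + b i < 1 / 5` and stay inside all the strips.
    refine numRegions_union_crossing_bar b (fun i => b i ^ 2) (fun i => 1 - b i ^ 2)
      ((hKc.union hA₁c).union hA₂c)
      (fun i => (hSK i).trans (Set.subset_union_left.trans Set.subset_union_left)) a (a ^ 2)
      (1 - a ^ 2) (Set.subset_union_right.trans Set.subset_union_left) Set.subset_union_right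
      ?_ (1 / 4) (by norm_num) (fun i => a + b i) ?_ ?_ (fun i => a - b i) hab ?_ ?_ ?_
    · rintro x ((hx | hx) | hx) - h1 h2
      · exact hKS x hx
      · exact absurd hx h2.ne
      · exact absurd hx h1.ne'
    · intro i i' h
      exact hbinj i i' (by have : a + b i = a + b i' := h
                           linarith)
    · intro i
      have := hb0 i; have := hba i
      constructor <;> linarith
    · intro y hy
      obtain ⟨hy0, hy1⟩ := hy
      constructor
      · have : 0 < a ^ 2 * y := by positivity
        nlinarith
      · nlinarith
    · intro i y hy
      obtain ⟨hy0, hy1⟩ := hy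
      have := hb0 i; have := hba i; have := hsq i
      have e1 : a * y < 1 / 10 := by nlinarith
      have e2 : 0 < a * y := by positivity
      have e3 : b i * (a ^ 2 - a * y) < 1 / 10 := by nlinarith
      have e4 : -(1 / 10) < b i * (a ^ 2 - a * y) := by nlinarith
      constructor <;> linarith
    · intro i y
      ring
  have e : K ∪ hFamily n = K ∪ A₁ ∪ A₂ ∪ A₃ := by
    rw [hFamily, hSet, ← Set.union_assoc, ← Set.union_assoc]
  rw [e]
  refine le_trans (le_of_eq ?_) ((add_le_add_left ((add_le_add_left s1 _).trans s2) _).trans s3)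
  rw [add_assoc, add_assoc, ← Nat.cast_add, ← Nat.cast_add]
  congr 2
  ring

/-! ### An extremal family of φ figures. -/

theorem exists_roots_of_neg {α β γ : ℝ} (hα : 0 < α) {u : ℝ} (hu : α * u ^ 2 + β * u + γ < 0) :
    ∃ l r, l < r ∧ ∀ x, α * x ^ 2 + β * x + γ = α * ((x - l) * (x - r)) := by
  have hD : 0 < β ^ 2 - 4 * α * γ := by nlinarith [sq_nonneg (2 * α * u + β)]
  have hs := Real.sq_sqrt hD.le
  have hs' := Real.sqrt_pos.2 hD
  set w := Real.sqrt (β ^ 2 - 4 * α * γ)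
  refine ⟨(-β - w) / (2 * α), (-β + w) / (2 * α), ?_, fun x => ?_⟩
  · gcongr
    linarith
  · field_simp
    linear_combination hs

theorem lt_and_lt_of_mul_neg {l r u : ℝ} (hlr : l < r) (h : (u - l) * (u - r) < 0) :
    l < u ∧ u < r := by
  constructor <;> by_contra hc <;> nlinarith

/-- The side of the line `y = a (x - 2 a)`. -/
def phiSide (a : ℝ) (x : Plane) : ℝ := x 1 - a * (x 0 - 2 * a)

/-- The power with respect to the circle with centre `(2 a, 0)` and radius `√(1 + a ^ 2)`. -/
def phiPower (a : ℝ) (x : Plane) : ℝ := x 0 ^ 2 + x 1 ^ 2 - 4 * a * x 0 + 3 * a ^ 2 - 1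

theorem continuous_phiSide (a : ℝ) : Continuous (phiSide a) := by
  unfold phiSide; fun_prop

theorem continuous_phiPower (a : ℝ) : Continuous (phiPower a) := by
  unfold phiPower; fun_prop

/-- The circle with centre `(2 a, 0)` and radius `√(1 + a ^ 2)`, and its diameter of slope `a`. -/
def phiSet (a : ℝ) : Set Plane := {x | phiPower a x = 0} ∪ {x | phiSide a x = 0}

theorem phiPower_eq_zero_iff (a : ℝ) (x : Plane) :
    phiPower a x = 0 ↔ (x 0 - 2 * a) ^ 2 + x 1 ^ 2 = 1 + a ^ 2 := by
  unfold phiPower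
  constructor <;> intro h <;> linear_combination h

theorem isConstrainedPhi_phiSet (a : ℝ) : IsConstrainedPhi (phiSet a) := by
  have hpos : 0 < 1 + a ^ 2 := by positivity
  have hu : (!₂[1, a] : Plane) ≠ 0 := plane_ne_zero_iff.2 (by simpa using hpos)
  refine ⟨!₂[2 * a, 0], !₂[1, a], √(1 + a ^ 2), Real.sqrt_pos.2 hpos, hu, ?_⟩
  change _ = _ ∪ lineThrough _ _
  ext x
  simp only [phiSet, Set.mem_union, Set.mem_ofPred_eq, mem_sphere_plane (Real.sqrt_nonneg _),
    mem_lineThrough_iff hu, Real.sq_sqrt hpos.le, phiPower_eq_zero_iff, phiSide]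
  refine or_congr (by simp) ?_
  simp [sub_eq_zero, mul_comm]

theorem isClosed_phiSet (a : ℝ) : IsClosed (phiSet a) :=
  (isClosed_eq (continuous_phiPower a) continuous_const).union
    (isClosed_eq (continuous_phiSide a) continuous_const)

theorem frontier_phiSide_pos (a : ℝ) : frontier {x | 0 < phiSide a x} ⊆ phiSet a := fun _ hx =>
  Or.inr (frontier_pos_subset (continuous_phiSide a) hx)

theorem frontier_phiSide_neg (a : ℝ) : frontier {x | 0 < -phiSide a x} ⊆ phiSet a := fun _ hx =>
  Or.inr (neg_eq_zero.1 (frontier_pos_subset (continuous_phiSide a).neg hx))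

theorem frontier_phiPower_pos (a : ℝ) : frontier {x | 0 < phiPower a x} ⊆ phiSet a := fun _ hx =>
  Or.inl (frontier_pos_subset (continuous_phiPower a) hx)

theorem frontier_phiPower_neg (a : ℝ) : frontier {x | 0 < -phiPower a x} ⊆ phiSet a := fun _ hx =>
  Or.inl (neg_eq_zero.1 (frontier_pos_subset (continuous_phiPower a).neg hx))

theorem frontier_inter_subset_of_subset {X : Type*} [TopologicalSpace X] {K s t : Set X}
    (hs : frontier s ⊆ K) (ht : frontier t ⊆ K) : frontier (s ∩ t) ⊆ K := fun _ hx =>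
  (frontier_inter_subset s t hx).elim (fun h => hs h.1) fun h => ht h.2

/-- The new line enters an old circle at `l i < 0`, crosses its diameter at `2 (a + b i)` in `(0, 4
/ 10)` and leaves the circle at `r i > 4 / 10`. -/
theorem numRegions_union_phi_line {n : ℕ} {a : ℝ} (ha0 : 0 < a) (ha1 : a < 1 / 10) (b : Fin n → ℝ)
    (hb0 : ∀ i, 0 < b i) (hba : ∀ i, b i < a) (hb : Function.Injective b) :
    numRegions (⋃ i, phiSet (b i)) + (3 * n + 1 : ℕ) ≤
      numRegions ((⋃ i, phiSet (b i)) ∪ {x | phiSide a x = 0}) := by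
  have hbs : ∀ i j, b i - b j = 0 → i = j := fun i j h => hb (sub_eq_zero.1 h)
  set K := ⋃ i, phiSet (b i) with hK
  have hKc : IsClosed K := isClosed_iUnion_of_finite fun i => isClosed_phiSet _
  have hSK : ∀ i, phiSet (b i) ⊆ K := fun i => Set.subset_iUnion (fun i => phiSet (b i)) i
  let γ : ℝ → Plane := fun x => !₂[x, a * (x - 2 * a)]
  have hside : ∀ i x, phiSide (b i) (γ x) = (a - b i) * (x - 2 * (a + b i)) := fun i x => by
    simp [phiSide, γ]; ring
  have hab : ∀ i, 0 < a - b i := fun i => sub_pos.2 (hba i)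
  have hpow : ∀ i, ∃ l r : ℝ, l < 0 ∧ 4 / 10 < r ∧
      ∀ x, phiPower (b i) (γ x) = (1 + a ^ 2) * ((x - l) * (x - r)) := by
    intro i
    have hexp : ∀ x, phiPower (b i) (γ x) = (1 + a ^ 2) * x ^ 2 + (-(4 * a ^ 3 + 4 * b i)) * x +
        (4 * a ^ 4 + 3 * b i ^ 2 - 1) := fun x => by simp [phiPower, γ]; ring
    have := hb0 i
    have := hba i
    have p2 : a ^ 2 < 1 / 100 := by nlinarith
    have p3 : 0 < a ^ 3 := by positivity
    have p4 : a ^ 4 < 1 / 100 := by nlinarith [sq_nonneg a]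
    have q2 : b i ^ 2 < 1 / 100 := by nlinarith
    -- The points of the new line with abscissas `0` and `4 / 10` are inside every old circle, so
    -- the roots lie on either side of both.
    have e0 : (1 + a ^ 2) * 0 ^ 2 + (-(4 * a ^ 3 + 4 * b i)) * 0 +
        (4 * a ^ 4 + 3 * b i ^ 2 - 1) < 0 := by linarith
    have e1 : (1 + a ^ 2) * (4 / 10) ^ 2 + (-(4 * a ^ 3 + 4 * b i)) * (4 / 10) +
        (4 * a ^ 4 + 3 * b i ^ 2 - 1) < 0 := by linarith
    have hpos : 0 < 1 + a ^ 2 := by positivity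
    obtain ⟨l, r, hlr, h⟩ := exists_roots_of_neg hpos e0
    rw [h] at e0 e1
    exact ⟨l, r, (lt_and_lt_of_mul_neg hlr (neg_of_mul_neg_right e0 hpos.le)).1,
      (lt_and_lt_of_mul_neg hlr (neg_of_mul_neg_right e1 hpos.le)).2, fun x => by rw [hexp, h]⟩
  choose l r hl hr hpow using hpow
  have hpos : 0 < 1 + a ^ 2 := by positivity
  have hmid : ∀ i, 0 < 2 * (a + b i) ∧ 2 * (a + b i) < 4 / 10 := fun i => by
    have := hb0 i; have := hba i
    constructor <;> linarith
  -- A point common to two different old circles has abscissa `3 (b i + b j) / 4`, which lies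
  -- strictly between `0` and `4 / 10`.
  have hsame : ∀ i j x, phiPower (b i) (γ x) = 0 → phiPower (b j) (γ x) = 0 →
      x < 0 ∨ 4 / 10 < x → i = j := by
    intro i j x hi hj hx
    have := hb0 i; have := hba i; have := hb0 j; have := hba j
    have hne : 3 * (b i + b j) - 4 * x ≠ 0 := by
      rcases hx with hx | hx
      · exact ne_of_gt (by linarith)
      · exact ne_of_lt (by linarith)
    refine hbs i j (mul_right_cancel₀ hne ?_)
    simp only [phiPower] at hi hj
    have g0 : γ x 0 = x := rfl
    rw [g0] at hi hj
    linear_combination hi - hj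
  let t : Fin n × Fin 3 → ℝ := fun z => ![l z.1, 2 * (a + b z.1), r z.1] z.2
  have ht : Function.Injective t := by
    refine injective_of_layers t 0 (4 / 10) hl hmid hr fun i j k h => ?_
    fin_cases k
    · have h : l i = l j := h
      exact hsame i j (l i) (by rw [hpow]; ring) (by rw [hpow, h]; ring) (Or.inl (hl i))
    · have h : 2 * (a + b i) = 2 * (a + b j) := h
      exact hbs i j (by linarith)
    · have h : r i = r j := h
      exact hsame i j (r i) (by rw [hpow]; ring) (by rw [hpow, h]; ring) (Or.inr (hr i))
  -- The exterior of an old circle switches twice along the new line; cutting it by a side of the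
  -- old diameter leaves one switch.
  let P : Fin n × Fin 3 → Set Plane := fun z =>
    ![({x | 0 < -phiSide (b z.1) x} ∩ {x | 0 < phiPower (b z.1) x})ᶜ, {x | 0 < phiSide (b z.1) x},
      {x | 0 < phiSide (b z.1) x} ∩ {x | 0 < phiPower (b z.1) x}] z.2
  have hPK : ∀ z, frontier (P z) ⊆ K := by
    rintro ⟨i, j⟩
    refine Set.Subset.trans ?_ (hSK i)
    fin_cases j
    · change frontier (_)ᶜ ⊆ _
      rw [frontier_compl]
      exact frontier_inter_subset_of_subset (frontier_phiSide_neg _) (frontier_phiPower_pos _)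
    · exact frontier_phiSide_pos _
    · exact frontier_inter_subset_of_subset (frontier_phiSide_pos _) (frontier_phiPower_pos _)
  have hsidepos : ∀ i x, 0 < phiSide (b i) (γ x) ↔ 2 * (a + b i) < x := fun i x => by
    rw [hside, mul_pos_iff_of_pos_left (hab i), sub_pos]
  have hsideneg : ∀ i x, 0 < -phiSide (b i) (γ x) ↔ x < 2 * (a + b i) := fun i x => by
    rw [hside, ← mul_neg, mul_pos_iff_of_pos_left (hab i), neg_sub, sub_pos]
  have hpowpos : ∀ i x, 0 < phiPower (b i) (γ x) ↔ x < l i ∨ r i < x := fun i x => by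
    have := hl i; have := hr i
    rw [hpow, mul_pos_iff_of_pos_left hpos, mul_pos_iff, sub_pos, sub_pos, sub_neg, sub_neg]
    constructor
    · rintro (⟨h1, h2⟩ | ⟨h1, h2⟩)
      · exact Or.inr h2
      · exact Or.inl h1
    · rintro (h | h)
      · exact Or.inr ⟨h, by linarith⟩
      · exact Or.inl ⟨by linarith, h⟩
  have hPt : ∀ z x, x ≠ t z → (γ x ∈ P z ↔ t z < x) := by
    rintro ⟨i, j⟩ x hx
    have := hl i; have := hr i; have := hmid i
    fin_cases j
    · change ¬ (0 < -phiSide (b i) (γ x) ∧ 0 < phiPower (b i) (γ x)) ↔ l i < x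
      have hx : x ≠ l i := hx
      rw [hsideneg, hpowpos]
      constructor
      · intro h
        by_contra hc
        have hlt := lt_of_le_of_ne (not_lt.1 hc) hx
        exact h ⟨by linarith, Or.inl hlt⟩
      · rintro h ⟨h1, h2 | h2⟩ <;> linarith
    · exact hsidepos i x
    · change (0 < phiSide (b i) (γ x) ∧ 0 < phiPower (b i) (γ x)) ↔ r i < x
      rw [hsidepos, hpowpos]
      constructor
      · rintro ⟨h1, h2 | h2⟩ <;> linarith
      · exact fun h => ⟨by linarith, Or.inr h⟩
  obtain ⟨M, hM⟩ := (Set.finite_range t).bddAbove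
  obtain ⟨M', hM'⟩ := (Set.finite_range t).bddBelow
  obtain ⟨T, hT, hTc, hTs⟩ := exists_pairwiseSeparated (K := K) γ
    (a := min M' M - 1) (b := max M' M + 1)
    (by linarith [min_le_left M' M, le_max_left M' M]) t ht
    (fun z => ⟨by linarith [min_le_left M' M, hM' ⟨z, rfl⟩],
      by linarith [le_max_right M' M, hM ⟨z, rfl⟩]⟩) P hPK (fun z x _ => hPt z x)
  simp only [Fintype.card_prod, Fintype.card_fin] at hTc
  rw [mul_comm 3 n, ← hTc]
  have hcs := continuous_phiSide a
  refine numRegions_add_encard_le hKc (P := {x : Plane | 0 < phiSide a x})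
    (Q := {x : Plane | phiSide a x < 0}) (isOpen_lt continuous_const hcs)
    (isOpen_lt hcs continuous_const) ?_ ?_ ?_ ?_ hTs
  · exact Set.disjoint_left.2 fun x hx hx' => lt_asymm (show 0 < phiSide a x from hx) hx'
  · intro x hx
    rcases lt_trichotomy (phiSide a x) 0 with h | h | h
    · exact Or.inr h
    · exact absurd (Or.inr h) hx
    · exact Or.inl h
  · rintro x ⟨hx, -⟩
    have hx : x 1 - a * (x 0 - 2 * a) = 0 := hx
    refine ⟨mem_closure_of_forall_smul (w := !₂[0, 1]) fun ε hε _ => ?_,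
      mem_closure_of_forall_smul (w := !₂[0, -1]) fun ε hε _ => ?_⟩
    · simp [phiSide]; linarith
    · simp [phiSide]; linarith
  · rintro _ hx
    obtain ⟨y, ⟨-, hy⟩, rfl⟩ := hT hx
    refine ⟨by simp [phiSide, γ], fun hyK => ?_⟩
    obtain ⟨i, hi⟩ := Set.mem_iUnion.1 hyK
    rcases hi with hi | hi
    · have hi : phiPower (b i) (γ y) = 0 := hi
      rw [hpow] at hi
      exact mul_ne_zero hpos.ne' (mul_ne_zero (sub_ne_zero.2 (hy (i, 0)))
        (sub_ne_zero.2 (hy (i, 2)))) hi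
    · have hi : phiSide (b i) (γ y) = 0 := hi
      rw [hside] at hi
      exact mul_ne_zero (hab i).ne' (sub_ne_zero.2 (hy (i, 1))) hi

/-- A quadratic that is positive at `0` and eventually negative changes sign once on `(0, ∞)`. -/
theorem exists_pos_root {A B C : ℝ} (hA : 0 < A) (hC : 0 < C) :
    ∃ p, 0 < p ∧ ∀ x, 0 < x → (C + B * x - A * x ^ 2 = 0 ↔ x = p) ∧
      (C + B * x - A * x ^ 2 < 0 ↔ p < x) := by
  have h0 : A * 0 ^ 2 + (-B) * 0 + (-C) < 0 := by linarith
  obtain ⟨l, r, hlr, h⟩ := exists_roots_of_neg hA h0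
  rw [h] at h0
  have hl := (lt_and_lt_of_mul_neg hlr (neg_of_mul_neg_right h0 hA.le)).1
  have hr := (lt_and_lt_of_mul_neg hlr (neg_of_mul_neg_right h0 hA.le)).2
  refine ⟨r, hr, fun x hx => ?_⟩
  have hpos : 0 < A * (x - l) := mul_pos hA (by linarith)
  have e : C + B * x - A * x ^ 2 = -(A * (x - l) * (x - r)) := by linear_combination -(h x)
  rw [e, neg_eq_zero, neg_lt_zero, mul_pos_iff_of_pos_left hpos, sub_pos, mul_eq_zero,
    or_iff_right hpos.ne', sub_eq_zero]
  exact ⟨Iff.rfl, Iff.rfl⟩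

/-- The rational parametrization of the circle `phiPower a = 0`. -/
noncomputable def phiArc (a ε τ : ℝ) : Plane :=
  !₂[2 * a + ((1 - τ ^ 2) - 2 * (ε * τ) * a) / (1 + τ ^ 2),
    (a * (1 - τ ^ 2) + 2 * (ε * τ)) / (1 + τ ^ 2)]

theorem phiPower_phiArc_self {a ε : ℝ} (hε : ε ^ 2 = 1) (τ : ℝ) : phiPower a (phiArc a ε τ) = 0 := by
  have h : 0 < 1 + τ ^ 2 := by positivity
  simp only [phiPower, phiArc, PiLp.toLp_apply, Matrix.cons_val_zero, Matrix.cons_val_one]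
  field_simp
  linear_combination (4 * τ ^ 2 * (1 + a ^ 2)) * hε

/-- For small parameters the quadratic in `τ` has positive constant and negative leading
coefficient, so `exists_pos_root` yields one crossing on each half circle. The factor `a - b`
appears on subtracting `phiPower a = 0`. -/
theorem phiPower_phiArc {a ε : ℝ} (hε : ε ^ 2 = 1) (b τ : ℝ) : phiPower b (phiArc a ε τ) =
    (a - b) / (1 + τ ^ 2) *
      ((4 + 5 * a - 3 * b) + (-(8 * a * ε)) * τ - (4 - 5 * a + 3 * b) * τ ^ 2) := by
  have h : 0 < 1 + τ ^ 2 := by positivity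
  rw [← sub_zero (phiPower b (phiArc a ε τ)), ← phiPower_phiArc_self hε τ]
  simp only [phiPower, phiArc, PiLp.toLp_apply, Matrix.cons_val_zero, Matrix.cons_val_one]
  field_simp
  linear_combination (4 * a ^ 2 * τ ^ 2 - 16 * τ ^ 2) * hε

theorem phiSide_phiArc {a b : ℝ} (hab : a - b ≠ 0) (ε τ : ℝ) : phiSide b (phiArc a ε τ) =
    (a - b) / (1 + τ ^ 2) *
      ((1 - 2 * b) + (2 * ε * (1 + a * b) / (a - b)) * τ - (1 + 2 * b) * τ ^ 2) := by
  have h : 0 < 1 + τ ^ 2 := by positivity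
  simp only [phiSide, phiArc, PiLp.toLp_apply, Matrix.cons_val_zero, Matrix.cons_val_one]
  field_simp
  ring

theorem phiSide_phiArc_self (a ε τ : ℝ) : phiSide a (phiArc a ε τ) =
    2 * (1 + a ^ 2) * τ / (1 + τ ^ 2) * ε := by
  have h : 0 < 1 + τ ^ 2 := by positivity
  simp only [phiSide, phiArc, PiLp.toLp_apply, Matrix.cons_val_zero, Matrix.cons_val_one]
  field_simp
  ring

/-- Such points are strictly inside the circle. This rules out that the new circle passes through a
point where two old lines meet, or meets an old line and an old circle together. -/
theorem phiPower_ne_zero_of_near {a : ℝ} (ha0 : 0 < a) (ha1 : a < 1 / 10) {x : Plane}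
    (h0 : 0 < x 0) (h1 : x 0 < 4 / 10) (h2 : -(1 / 10) < x 1) (h3 : x 1 < 1 / 10) :
    phiPower a x ≠ 0 := by
  apply ne_of_lt
  unfold phiPower
  have e1 : x 0 ^ 2 < 16 / 100 := by nlinarith
  have e2 : x 1 ^ 2 < 1 / 100 := by nlinarith
  have e3 : a ^ 2 < 1 / 100 := by nlinarith
  have e4 : 0 < a * x 0 := mul_pos ha0 h0
  linarith

theorem mul_neg_iff_of_pos {c y : ℝ} (hc : 0 < c) : c * y < 0 ↔ y < 0 := by
  rw [← neg_pos, ← mul_neg, mul_pos_iff_of_pos_left hc, neg_pos]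

/-- Each half of the new circle crosses every old line and every old circle exactly once, at `2 * n`
distinct parameters. -/
theorem exists_pairwiseSeparated_phiArc {n : ℕ} {a : ℝ} (ha0 : 0 < a) (ha1 : a < 1 / 10)
    (b : Fin n → ℝ) (hb0 : ∀ i, 0 < b i) (hba : ∀ i, b i < a) (hb : Function.Injective b)
    {ε : ℝ} (hε : ε ^ 2 = 1) :
    ∃ T : Set Plane, T ⊆ {x | phiPower a x = 0} \
        ((⋃ i, phiSet (b i)) ∪ {x | phiSide a x = 0}) ∧ (∀ x ∈ T, 0 < phiSide a x * ε) ∧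
      T.encard = (2 * n + 1 : ℕ) ∧ PairwiseSeparated (⋃ i, phiSet (b i)) T := by
  set K := ⋃ i, phiSet (b i) with hK
  have hSK : ∀ i, phiSet (b i) ⊆ K := fun i => Set.subset_iUnion (fun i => phiSet (b i)) i
  have hab : ∀ i, 0 < a - b i := fun i => sub_pos.2 (hba i)
  have hline : ∀ i, ∃ p, 0 < p ∧ ∀ τ, 0 < τ → (phiSide (b i) (phiArc a ε τ) = 0 ↔ τ = p) ∧
      (phiSide (b i) (phiArc a ε τ) < 0 ↔ p < τ) := by
    intro i
    have := hb0 i; have := hba i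
    obtain ⟨p, hp, h⟩ := exists_pos_root (A := 1 + 2 * b i) (C := 1 - 2 * b i)
      (B := 2 * ε * (1 + a * b i) / (a - b i)) (by linarith) (by linarith)
    refine ⟨p, hp, fun τ hτ => ?_⟩
    have hc : 0 < (a - b i) / (1 + τ ^ 2) := div_pos (hab i) (by positivity)
    rw [phiSide_phiArc (hab i).ne', mul_eq_zero, or_iff_right hc.ne', mul_neg_iff_of_pos hc]
    exact h τ hτ
  have hcirc : ∀ i, ∃ p, 0 < p ∧ ∀ τ, 0 < τ → (phiPower (b i) (phiArc a ε τ) = 0 ↔ τ = p) ∧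
      (phiPower (b i) (phiArc a ε τ) < 0 ↔ p < τ) := by
    intro i
    have := hb0 i; have := hba i
    obtain ⟨p, hp, h⟩ := exists_pos_root (A := 4 - 5 * a + 3 * b i) (C := 4 + 5 * a - 3 * b i)
      (B := -(8 * a * ε)) (by linarith) (by linarith)
    refine ⟨p, hp, fun τ hτ => ?_⟩
    have hc : 0 < (a - b i) / (1 + τ ^ 2) := div_pos (hab i) (by positivity)
    rw [phiPower_phiArc hε, mul_eq_zero, or_iff_right hc.ne', mul_neg_iff_of_pos hc]
    exact h τ hτ
  choose p hp0 hp using hline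
  choose q hq0 hq using hcirc
  have hpz : ∀ i, phiSide (b i) (phiArc a ε (p i)) = 0 := fun i => ((hp i _ (hp0 i)).1).2 rfl
  have hqz : ∀ i, phiPower (b i) (phiArc a ε (q i)) = 0 := fun i => ((hq i _ (hq0 i)).1).2 rfl
  have hself := fun τ => phiPower_phiArc_self (a := a) hε τ
  have hx : ∀ i x, phiPower a x = 0 → phiPower (b i) x = 0 → 4 * x 0 = 3 * (a + b i) := by
    intro i x h1 h2
    simp only [phiPower] at h1 h2
    apply mul_left_cancel₀ (hab i).ne'
    linear_combination h2 - h1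
  -- The new circle meets old circle `j` at abscissa `3 (a + b j) / 4`; a point of an old line with
  -- that abscissa is close to the horizontal axis, hence inside the new circle.
  have hpq : ∀ i j, p i ≠ q j := by
    intro i j h
    have h1 := hx j _ (hself (q j)) (hqz j)
    have h2 := hpz i
    rw [h] at h2
    have := hb0 i; have := hba i; have := hb0 j; have := hba j
    simp only [phiSide] at h2
    refine phiPower_ne_zero_of_near ha0 ha1 (by linarith) (by linarith) ?_ ?_ (hself (q j)) <;>
      nlinarith
  have hpp : ∀ i j, p i = p j → i = j := by
    intro i j h
    by_contra hij
    have hne : b i - b j ≠ 0 := sub_ne_zero.2 fun h => hij (hb h)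
    have h1 := hpz i
    have h2 := hpz j
    rw [← h] at h2
    simp only [phiSide] at h1 h2
    have := hb0 i; have := hba i; have := hb0 j; have := hba j
    -- Two old lines meet at `(2 (b i + b j), 2 b i b j)`, again inside the new circle.
    have h3 : phiArc a ε (p i) 0 = 2 * (b i + b j) := by
      apply mul_left_cancel₀ hne
      linear_combination h2 - h1
    rw [h3] at h1
    have h4 : phiArc a ε (p i) 1 = 2 * (b i * b j) := by linear_combination h1
    have h5 : 0 < b i * b j := mul_pos (hb0 i) (hb0 j)
    have h6 : b i * b j < 1 / 100 := by nlinarith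
    exact phiPower_ne_zero_of_near ha0 ha1 (by linarith) (by linarith) (by linarith) (by linarith)
      (hself (p i))
  have hqq : ∀ i j, q i = q j → i = j := by
    intro i j h
    have h1 := hx i _ (hself (q i)) (hqz i)
    have h2 := hx j _ (hself (q j)) (hqz j)
    rw [← h] at h2
    exact hb (by linarith)
  let t : Fin n ⊕ Fin n → ℝ := Sum.elim p q
  have ht : Function.Injective t := by
    rintro (i | i) (j | j) h
    · rw [hpp i j h]
    · exact absurd h (hpq i j)
    · exact absurd h.symm (hpq j i)
    · rw [hqq i j h]
  have ht0 : ∀ z, 0 < t z := by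
    rintro (i | i)
    exacts [hp0 i, hq0 i]
  obtain ⟨M, hM⟩ := (Set.finite_range t).bddAbove
  obtain ⟨T, hT, hTc, hTs⟩ := exists_pairwiseSeparated (K := K) (phiArc a ε)
    (a := 0) (b := max 0 M + 1) (by linarith [le_max_left 0 M]) t ht
    (fun z => ⟨ht0 z, by linarith [le_max_right 0 M, hM ⟨z, rfl⟩]⟩)
    (Sum.elim (fun i => {x | 0 < -phiSide (b i) x}) (fun i => {x | 0 < -phiPower (b i) x}))
    (by
      rintro (i | i)
      · exact (frontier_phiSide_neg _).trans (hSK i)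
      · exact (frontier_phiPower_neg _).trans (hSK i))
    (by
      rintro (i | i) τ hτ -
      · exact neg_pos.trans (hp i τ hτ.1).2
      · exact neg_pos.trans (hq i τ hτ.1).2)
  have hside : ∀ τ, 0 < τ → 0 < phiSide a (phiArc a ε τ) * ε := by
    intro τ hτ
    rw [phiSide_phiArc_self, mul_assoc, ← sq, hε]
    positivity
  refine ⟨T, ?_, ?_, ?_, hTs⟩
  · intro x hx
    obtain ⟨τ, ⟨hτ, hne⟩, rfl⟩ := hT hx
    refine ⟨hself τ, ?_⟩
    rintro (h | h)
    · obtain ⟨i, hi | hi⟩ := Set.mem_iUnion.1 h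
      · exact hne (Sum.inr i) (((hq i τ hτ.1).1).1 hi)
      · exact hne (Sum.inl i) (((hp i τ hτ.1).1).1 hi)
    · have h : phiSide a (phiArc a ε τ) = 0 := h
      have := hside τ hτ.1
      rw [h, zero_mul] at this
      exact lt_irrefl _ this
  · intro x hx
    obtain ⟨τ, ⟨hτ, -⟩, rfl⟩ := hT hx
    exact hside τ hτ.1
  · rw [hTc]
    simp [two_mul]

/-- Each half circle carries `2 * n + 1` separated points, and the new diameter, already drawn,
separates the two halves. -/
theorem numRegions_union_phi_circle {n : ℕ} {a : ℝ} (ha0 : 0 < a) (ha1 : a < 1 / 10)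
    (b : Fin n → ℝ) (hb0 : ∀ i, 0 < b i) (hba : ∀ i, b i < a) (hb : Function.Injective b) :
    numRegions ((⋃ i, phiSet (b i)) ∪ {x | phiSide a x = 0}) + (4 * n + 2 : ℕ) ≤
      numRegions ((⋃ i, phiSet (b i)) ∪ {x | phiSide a x = 0} ∪ {x | phiPower a x = 0}) := by
  obtain ⟨T, hT, hTs, hTc, hTp⟩ :=
    exists_pairwiseSeparated_phiArc ha0 ha1 b hb0 hba hb (ε := 1) (by norm_num)
  obtain ⟨T', hT', hTs', hTc', hTp'⟩ :=
    exists_pairwiseSeparated_phiArc ha0 ha1 b hb0 hba hb (ε := -1) (by norm_num)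
  have hd : Disjoint T' {x | 0 < phiSide a x} := by
    refine Set.disjoint_left.2 fun x hx hx' => ?_
    have h1 := hTs' x hx
    have h2 : 0 < phiSide a x := hx'
    linarith
  have hTP : T ⊆ {x | 0 < phiSide a x} := fun x hx => by simpa using hTs x hx
  have hcard : (T ∪ T').encard = (4 * n + 2 : ℕ) := by
    rw [Set.encard_union_eq (hd.symm.mono_left hTP), hTc, hTc', ← Nat.cast_add]
    congr 1
    ring
  have hcs := continuous_phiSide a
  have hcp := continuous_phiPower a
  rw [← hcard]
  refine numRegions_add_encard_le ((isClosed_iUnion_of_finite fun i => isClosed_phiSet _).union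
    (isClosed_eq hcs continuous_const)) (P := {x : Plane | 0 < phiPower a x})
    (Q := {x : Plane | phiPower a x < 0}) (isOpen_lt continuous_const hcp)
    (isOpen_lt hcp continuous_const) ?_ ?_ ?_ (Set.union_subset hT hT')
    ((hTp.mono Set.subset_union_left).union (hTp'.mono Set.subset_union_left)
      (fun x hx => Or.inr (frontier_pos_subset hcs hx)) hTP hd)
  · exact Set.disjoint_left.2 fun x hx hx' => lt_asymm (show 0 < phiPower a x from hx) hx'
  · intro x hx
    rcases lt_trichotomy (phiPower a x) 0 with h | h | h
    · exact Or.inr h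
    · exact absurd (Or.inr h) hx
    · exact Or.inl h
  · rintro x ⟨hx, -⟩
    have hx := (phiPower_eq_zero_iff a x).1 hx
    -- Both sides are reached along the radius, outward and inward.
    refine ⟨mem_closure_of_forall_smul (w := !₂[x 0 - 2 * a, x 1]) fun ε hε _ => ?_,
      mem_closure_of_forall_smul (w := !₂[-(x 0 - 2 * a), -x 1]) fun ε hε hε1 => ?_⟩
    · change 0 < phiPower a _
      have e : phiPower a (x + ε • !₂[x 0 - 2 * a, x 1]) = ε * (2 + ε) * (1 + a ^ 2) := by
        simp [phiPower]
        linear_combination (1 + ε) ^ 2 * hx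
      rw [e]
      positivity
    · change phiPower a _ < 0
      have e : phiPower a (x + ε • !₂[-(x 0 - 2 * a), -x 1]) = -(ε * (2 - ε) * (1 + a ^ 2)) := by
        simp [phiPower]
        linear_combination (1 - ε) ^ 2 * hx
      rw [e]
      have : 0 < 2 - ε := by linarith
      exact neg_neg_of_pos (by positivity)

theorem numRegions_add_le_union_phiFamily (n : ℕ) :
    numRegions (⋃ i : Fin n, phiSet (tilt i)) + (7 * n + 3 : ℕ) ≤
      numRegions ((⋃ i : Fin n, phiSet (tilt i)) ∪ phiSet (tilt n)) := by
  have hinj : Function.Injective fun i : Fin n => tilt i := fun i j h =>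
    Fin.ext (tilt_strictMono.injective h)
  have s1 := numRegions_union_phi_line (tilt_pos n) (tilt_lt n) (fun i : Fin n => tilt i)
    (fun i => tilt_pos i) (fun i => tilt_strictMono i.2) hinj
  have s2 := numRegions_union_phi_circle (tilt_pos n) (tilt_lt n) (fun i : Fin n => tilt i)
    (fun i => tilt_pos i) (fun i => tilt_strictMono i.2) hinj
  have e : (⋃ i : Fin n, phiSet (tilt i)) ∪ phiSet (tilt n) =
      (⋃ i : Fin n, phiSet (tilt i)) ∪ {x | phiSide (tilt n) x = 0} ∪
        {x | phiPower (tilt n) x = 0} := by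
    rw [Set.union_assoc, Set.union_comm {x | phiSide (tilt n) x = 0}, ← phiSet]
  rw [e]
  refine le_trans (le_of_eq ?_) ((add_le_add_left s1 _).trans s2)
  rw [add_assoc, ← Nat.cast_add]
  congr 2
  ring

/-! ### Pairs with seven common points, and the conclusion. -/

theorem encard_seven {X : Type*} (l : List X) (hl : l.Nodup) (h7 : l.length = 7) :
    {x | x ∈ l}.encard = 7 := by
  classical
  have : {x | x ∈ l} = (l.toFinset : Set X) := by ext; simp
  rw [this, Set.encard_coe_eq_coe_finsetCard, List.toFinset_card_of_nodup hl, h7]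
  rfl

theorem seven_mem_meetingCounts {shape : Set Plane → Prop} {S T : Set Plane} (hS : shape S)
    (hT : shape T) (l : List Plane) (hl : l.Nodup) (h7 : l.length = 7)
    (h : ∀ x, x ∈ S ∩ T ↔ x ∈ l) : 7 ∈ meetingCounts shape := by
  have e : S ∩ T = {x | x ∈ l} := Set.ext h
  refine ⟨S, T, hS, hT, e ▸ l.finite_toSet, ?_⟩
  rw [e, encard_seven l hl h7]

theorem eq_vec_iff (x : Plane) (u v : ℝ) : x = !₂[u, v] ↔ x 0 = u ∧ x 1 = v :=
  ⟨fun h => by simp [h], fun h => plane_ext h.1 h.2⟩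

theorem vec_eq_vec_iff (u v u' v' : ℝ) : (!₂[u, v] : Plane) = !₂[u', v'] ↔ u = u' ∧ v = v' :=
  eq_vec_iff _ _ _

/-- Both figures are centred at the origin and inclined at 45°. The lines `y = ± 2` are too far
apart for the shorter crossbar to reach, so only those two of the nine pairs of pieces miss each
other. -/
theorem seven_mem_meetingCounts_constrainedH : 7 ∈ meetingCounts IsConstrainedH := by
  refine seven_mem_meetingCounts (isConstrainedH_hSet 0 0 (h := 2) two_pos)
    (isConstrainedH_hSet 1 0 (h := 1) one_pos)
    [!₂[1, 2], !₂[-3, -2], !₂[0, 1], !₂[3, 2], !₂[-1, -2], !₂[0, -1], !₂[0, 0]] ?_ rfl ?_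
  · simp only [List.nodup_cons, List.mem_cons, vec_eq_vec_iff]
    norm_num
  · intro x
    simp only [hSet, Set.mem_inter_iff, Set.mem_union, Set.mem_ofPred_eq, List.mem_cons,
      eq_vec_iff, List.not_mem_nil, or_false]
    constructor
    · rintro ⟨(h | h) | ⟨h, h'⟩, (k | k) | ⟨k, k'⟩⟩
      · exact Or.inl ⟨by linarith, by linarith⟩
      · exact Or.inr (Or.inr (Or.inr (Or.inl ⟨by linarith, by linarith⟩)))
      · exfalso; linarith [k'.1, k'.2]
      · exact Or.inr (Or.inl ⟨by linarith, by linarith⟩)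
      · exact Or.inr (Or.inr (Or.inr (Or.inr (Or.inl ⟨by linarith, by linarith⟩))))
      · exfalso; linarith [k'.1, k'.2]
      · exact Or.inr (Or.inr (Or.inl ⟨by linarith, by linarith⟩))
      · exact Or.inr (Or.inr (Or.inr (Or.inr (Or.inr (Or.inl ⟨by linarith, by linarith⟩)))))
      · exact Or.inr (Or.inr (Or.inr (Or.inr (Or.inr (Or.inr ⟨by linarith, by linarith⟩)))))
    · rintro (⟨h, k⟩ | ⟨h, k⟩ | ⟨h, k⟩ | ⟨h, k⟩ | ⟨h, k⟩ | ⟨h, k⟩ | ⟨h, k⟩) <;> rw [h, k] <;>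
        norm_num

theorem isConstrainedPhi_of_coords (c u : Plane) {r : ℝ} (hr : 0 < r) (hu : u ≠ 0) :
    IsConstrainedPhi {x | (x 0 - c 0) ^ 2 + (x 1 - c 1) ^ 2 = r ^ 2 ∨
      (x 1 - c 1) * u 0 = (x 0 - c 0) * u 1} := by
  refine ⟨c, u, r, hr, hu, ?_⟩
  change _ = _ ∪ lineThrough c u
  ext x
  rw [Set.mem_union, mem_sphere_plane hr.le, mem_lineThrough_iff hu]
  rfl

/-- Radius 5 at the origin and radius √17 at `(0, 4)`, with perpendicular diameters, make all seven
common points integral. -/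
theorem seven_mem_meetingCounts_constrainedPhi : 7 ∈ meetingCounts IsConstrainedPhi := by
  have h17 : (√17 : ℝ) ^ 2 = 17 := Real.sq_sqrt (by norm_num)
  refine seven_mem_meetingCounts
    (isConstrainedPhi_of_coords !₂[0, 0] !₂[1, 0] (r := 5) (by norm_num)
      (plane_ne_zero_iff.2 (by simp)))
    (isConstrainedPhi_of_coords !₂[0, 4] !₂[0, 1] (r := √17) (by positivity)
      (plane_ne_zero_iff.2 (by simp)))
    [!₂[4, 3], !₂[-4, 3], !₂[1, 0], !₂[-1, 0], !₂[0, 5], !₂[0, -5], !₂[0, 0]] ?_ rfl ?_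
  · simp only [List.nodup_cons, List.mem_cons, vec_eq_vec_iff]
    norm_num
  · intro x
    simp only [Set.mem_inter_iff, Set.mem_ofPred_eq, List.mem_cons, eq_vec_iff, List.not_mem_nil,
      or_false, h17, Matrix.cons_val_zero, Matrix.cons_val_one]
    constructor
    · rintro ⟨h | h, k | k⟩
      · have h1 : x 1 = 3 := by linarith
        rw [h1] at h
        have h2 : (x 0 - 4) * (x 0 + 4) = 0 := by linarith
        rcases mul_eq_zero.1 h2 with h2 | h2
        · exact Or.inl ⟨by linarith, h1⟩
        · exact Or.inr (Or.inl ⟨by linarith, h1⟩)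
      · have h1 : x 0 = 0 := by linarith
        rw [h1] at h
        have h2 : (x 1 - 5) * (x 1 + 5) = 0 := by linarith
        rcases mul_eq_zero.1 h2 with h2 | h2
        · exact Or.inr (Or.inr (Or.inr (Or.inr (Or.inl ⟨h1, by linarith⟩))))
        · exact Or.inr (Or.inr (Or.inr (Or.inr (Or.inr (Or.inl ⟨h1, by linarith⟩)))))
      · have h1 : x 1 = 0 := by linarith
        rw [h1] at k
        have h2 : (x 0 - 1) * (x 0 + 1) = 0 := by linarith
        rcases mul_eq_zero.1 h2 with h2 | h2
        · exact Or.inr (Or.inr (Or.inl ⟨by linarith, h1⟩))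
        · exact Or.inr (Or.inr (Or.inr (Or.inl ⟨by linarith, h1⟩)))
      · exact Or.inr (Or.inr (Or.inr (Or.inr (Or.inr (Or.inr ⟨by linarith, by linarith⟩)))))
    · rintro (⟨h, k⟩ | ⟨h, k⟩ | ⟨h, k⟩ | ⟨h, k⟩ | ⟨h, k⟩ | ⟨h, k⟩ | ⟨h, k⟩) <;> rw [h, k] <;>
        norm_num

theorem mainTheorem7 :
    (IsGreatest (meetingCounts IsConstrainedH) 7 ∧
      ∀ n : ℕ, IsGreatest (regionCounts IsConstrainedH n)
        (((7 * n ^ 2 - n + 2) / 2 : ℕ) : ℕ∞)) ∧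
    (IsGreatest (meetingCounts IsConstrainedPhi) 7 ∧
      ∀ n : ℕ, IsGreatest (regionCounts IsConstrainedPhi n)
        (((7 * n ^ 2 - n + 2) / 2 : ℕ) : ℕ∞)) := by
  refine ⟨⟨⟨seven_mem_meetingCounts_constrainedH, ?_⟩,
      isGreatest_regionCounts IsConstrainedH numRegions_union_constrainedH_le hFamily
        isConstrainedH_hFamily numRegions_add_le_union_hFamily⟩,
    ⟨⟨seven_mem_meetingCounts_constrainedPhi, ?_⟩,
      isGreatest_regionCounts IsConstrainedPhi numRegions_union_constrainedPhi_le
        (fun n => phiSet (tilt n)) (fun n => isConstrainedPhi_phiSet _)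
        numRegions_add_le_union_phiFamily⟩⟩
  · rintro _ ⟨S, T, ⟨p, q, hpq, rfl⟩, ⟨p', q', hpq', rfl⟩, hfin, rfl⟩
    exact encard_hFigure_inter_le hpq hpq' hfin
  · rintro _ ⟨S, T, ⟨c, u, r, hr, hu, rfl⟩, ⟨c', u', r', hr', hu', rfl⟩, hfin, rfl⟩
    exact encard_phiFigure_inter_le hr hr' hu hu' hfin
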